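/- Let $\lambda>0$ and $0<\sigma<1$. On $(-1,1)$ put $d\mu_\lambda(x)=(1-x^2)^{\lambda-1/2}\,dx$, let $C_n^\lambda$ be the ultraspherical (Gegenbauer) polynomials, given by $C_0^\lambda(x)=1$, $C_1^\lambda(x)=2\lambda x$ and $(n+2)C_{n+2}^\lambda(x)=2(n+1+\lambda)xC_{n+1}^\lambda(x)-(n+2\lambda)C_n^\lambda(x)$ for $n\ge 0$, and let $c_n^\lambda=C_n^\lambda/\|C_n^\lambda\|_{L^2(\mu_\lambda)}$ and $a_n^\lambda(f)=\int_{-1}^1 f c_n^\lambda\,d\mu_\lambda$. Let $H^\sigma_\lambda$ be the space of real-valued $f\in L^2((-1,1),\mu_\lambda)$ with $\sum_{n\ge 0}(n+\lambda)^\sigma a_n^\lambda(f)^2<\infty$, and let $$A^\lambda_\sigma f=\sum_{n=0}^\infty \frac{\Gamma\left(n+\lambda+\frac{1+\sigma}{2}\right)}{\Gamma\left(n+\lambda+\frac{1-\sigma}{2}\right)}\,a_n^\lambda(f)\,c_n^\lambda .$$ For $u\in H^\sigma_\lambda$ let $\langle u,A^\lambda_\sigma u\rangle_\lambda=\int_{-1}^1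 u\,A^\lambda_\sigma u\,d\mu_\lambda$ be understood as the duality pairing obtained by integrating this series against $u$ term by term. Then, for every $u\in H^\sigma_\lambda$: (i) this pairing is finite and $$\langle u,A^\lambda_\sigma u\rangle_\lambda=\sum_{n=0}^\infty \frac{\Gamma\left(n+\lambda+\frac{1+\sigma}{2}\right)}{\Gamma\left(n+\lambda+\frac{1-\sigma}{2}\right)}\,a_n^\lambda(u)^2 ;$$ if moreover the series of $A^\lambda_\sigma u$ converges in $L^2(\mu_\lambda)$ to a function $g$, then $\langle u,A^\lambda_\sigma u\rangle_\lambda=\int_{-1}^1 u\,g\,d\mu_\lambda$; (ii) (Heisenberg-type uncertainty principle) the integrals below are finite and $$Q_{\sigma,\lambda}\left(\int_{-1}^1 u^2\,d\mu_\lambda\right)^2\le \int_{-1}^1 u^2(x)(1-x^2)^{\sigma/2}\,d\mu_\lambda(x)\cdot\langle u,A^\lambda_\sigma u\rangle_\lambda,\qquad Q_{\sigma,\lambda}=2^\sigma\,\frac{\Gamma\left(\frac{\lambda}{2}+\frac{1+\sigma}{4}\right)^2}{\Gamma\left(\frac{\lambda}{2}+\frac{1-\sigma}{4}\right)^2}.$$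 -/

import Mathlib

open MeasureTheory Set Filter Topology

noncomputable section

/-- The measure `dμ_λ(x) = (1 - x²)^(λ - 1/2) dx` on the interval `(-1, 1)`. -/
def ultraMeasure (lam : ℝ) : Measure ℝ :=
  (volume.restrict (Ioo (-1 : ℝ) 1)).withDensity
    (fun x => ENNReal.ofReal ((1 - x ^ 2) ^ (lam - 1 / 2)))

/-- The ultraspherical (Gegenbauer) polynomials `C_n^λ`, by their three-term recurrence
`(n + 2) C_{n+2} = 2 (n + 1 + λ) x C_{n+1} - (n + 2 λ) C_n`, `C_0 = 1`, `C_1 = 2 λ x`. -/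
def ultraPoly (lam : ℝ) : ℕ → Polynomial ℝ
  | 0 => 1
  | 1 => Polynomial.C (2 * lam) * Polynomial.X
  | n + 2 =>
      Polynomial.C (2 * ((n : ℝ) + 1 + lam) / ((n : ℝ) + 2)) * Polynomial.X
          * ultraPoly lam (n + 1)
        - Polynomial.C (((n : ℝ) + 2 * lam) / ((n : ℝ) + 2)) * ultraPoly lam n

/-- The norm `d_n` of `C_n^λ` in `L²(μ_λ)`. -/
def ultraNorm (lam : ℝ) (n : ℕ) : ℝ :=
  Real.sqrt (∫ x, ((ultraPoly lam n).eval x) ^ 2 ∂(ultraMeasure lam))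

/-- The normalized ultraspherical polynomials `c_n^λ = d_n⁻¹ C_n^λ`. -/
def ultraBasis (lam : ℝ) (n : ℕ) (x : ℝ) : ℝ :=
  (ultraNorm lam n)⁻¹ * (ultraPoly lam n).eval x

/-- The Fourier coefficients `a_n^λ(f) = ∫ f c_n^λ dμ_λ`. -/
def ultraCoeff (lam : ℝ) (f : ℝ → ℝ) (n : ℕ) : ℝ :=
  ∫ y, f y * ultraBasis lam n y ∂(ultraMeasure lam)

/-- The Sobolev space `H^σ_λ`: functions in `L²(μ_λ)` with `∑ (n + λ)^σ a_n(f)² < ∞`. -/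
def ultraSobolev (sigma lam : ℝ) : Set (ℝ → ℝ) :=
  {f | MemLp f 2 (ultraMeasure lam) ∧
    Summable (fun n : ℕ => ((n : ℝ) + lam) ^ sigma * (ultraCoeff lam f n) ^ 2)}

/-- The spectral multiplier `Γ(n + λ + (1 + σ)/2) / Γ(n + λ + (1 - σ)/2)` of `A_σ^λ`. -/
def ultraMultiplier (sigma lam : ℝ) (n : ℕ) : ℝ :=
  Real.Gamma ((n : ℝ) + lam + (1 + sigma) / 2) / Real.Gamma ((n : ℝ) + lam + (1 - sigma) / 2)

/-- The `n`-th term of the series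
`A_σ^λ f = ∑ Γ(n + λ + (1 + σ)/2) / Γ(n + λ + (1 - σ)/2) a_n(f) c_n`. -/
def ultraOpTerm (sigma lam : ℝ) (f : ℝ → ℝ) (n : ℕ) (x : ℝ) : ℝ :=
  ultraMultiplier sigma lam n * ultraCoeff lam f n * ultraBasis lam n x

/-- `A_σ^λ f = g` as functions in `L²(μ_λ)`: the series of `A_σ^λ f` converges to `g` in
`L²(μ_λ)`. -/
def IsUltraOp (sigma lam : ℝ) (f g : ℝ → ℝ) : Prop :=
  MemLp g 2 (ultraMeasure lam) ∧
    Tendsto (fun N : ℕ => eLpNorm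
        (fun x => (∑ n ∈ Finset.range N, ultraOpTerm sigma lam f n x) - g x) 2
        (ultraMeasure lam))
      atTop (𝓝 0)

/-- The pairing `⟨v, A_σ^λ u⟩_λ = ∫ v A_σ^λ u dμ_λ`, where the series of `A_σ^λ u` is integrated
against `v` term by term. For `u, v` in `H^σ_λ` the series of `A_σ^λ u` converges in the dual of
`H^σ_λ`, in general not in `L²(μ_λ)`, and this is the duality pairing. -/
def ultraPairing (sigma lam : ℝ) (v u : ℝ → ℝ) : ℝ :=
  ∑' n : ℕ, ∫ x, v x * ultraOpTerm sigma lam u n x ∂(ultraMeasure lam)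

/-- The constant `Q_{σ,λ} = 2^σ Γ(λ/2 + (1 + σ)/4)² / Γ(λ/2 + (1 - σ)/4)²`. -/
def ultraHardyConst (sigma lam : ℝ) : ℝ :=
  (2 : ℝ) ^ sigma * (Real.Gamma (lam / 2 + (1 + sigma) / 4) ^ 2
    / Real.Gamma (lam / 2 + (1 - sigma) / 4) ^ 2)

end

/-!
The inequality is the dual form of the sharp Hardy inequality
`Q ∫ u² (1 - x²)^(-σ/2) dμ ≤ ⟨u, A u⟩`, tested on `u` itself. Let `T = A⁻¹`, the operator with
multiplier `Γ(n + λ + (1 - σ)/2) / Γ(n + λ + (1 + σ)/2)`. The Cauchy-Schwarz inequality in Fourier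
coefficients gives `(∫ u q dμ)² ≤ ⟨u, A u⟩ ∫ q T q dμ` (`sq_integral_mul_le_ultraPairing_mul`), so
it is enough to show `Q ∫ q T q dμ ≤ ∫ q² (1 - x²)^(σ/2) dμ` and to let `q → u` in `L²(μ)`.

This bound on `T` is a Schur test with the function `Φ = (1 - x²)^(-(2λ+1+σ)/4)`. It has two
ingredients, both proved on polynomials, without a kernel for `T`.

* `T` preserves positivity on `[-1, 1]` (`ultraMult_ultraInvMultiplier_nonneg`). By Euler's Beta
  integral `T` is an average of the Poisson semigroup `e^{-s √(L + λ²)}`, where `L` is the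
  ultraspherical operator with `L C_n = n (n + 2λ) C_n`, and the semigroup is positive by the
  minimum principle for the elliptic equation `∂²v/∂s² = L v + λ² v`
  (`sum_exp_mul_ultraPoly_nonneg`).
* `T Φ = Q⁻¹ (1 - x²)^(σ/2) Φ`, in the weak form
  `ultraHardyConst_mul_weightInt_ultraMult`. By the three-term recurrence and integration by parts
  the moments `∫ C_n (1 - x²)^β dx` satisfy a two-step recurrence in `n`, which reduces the
  identity to `n = 0`, an evaluation of Beta integrals that produces `Q`.

The function `Φ` is replaced by its Taylor polynomials `φ`, which increase to `Φ`. For `q = φ g`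
positivity of `T` gives `∫ φ g T(φ g) dμ ≤ ∫ φ T(φ g²) dμ ≤ ∫ Φ T(φ g²) dμ`
(`weightInt_schur`, `weightInt_mul_le_weightInt`), and the last integral is
`Q⁻¹ ∫ φ g² (1 - x²)^(σ/2) Φ dμ`. As `φ` increases to `Φ` with `φ g` tending to a given continuous
function `f`, the right side tends to `Q⁻¹ ∫ f² (1 - x²)^(σ/2) dμ` (`dual_hardy_continuous`).
-/

open Polynomial

/-! ### Algebra of the ultraspherical polynomials -/

lemma ultraPoly_add_two (lam : ℝ) (n : ℕ) :
    C ((n : ℝ) + 2) * ultraPoly lam (n + 2) =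
      C (2 * ((n : ℝ) + 1 + lam)) * X * ultraPoly lam (n + 1)
        - C ((n : ℝ) + 2 * lam) * ultraPoly lam n := by
  have h : ((n : ℝ) + 2) ≠ 0 := by positivity
  rw [ultraPoly, mul_sub, ← mul_assoc, ← mul_assoc, ← mul_assoc, ← C_mul, ← C_mul,
    mul_div_cancel₀ _ h, mul_div_cancel₀ _ h]

/-- The two differential relations between consecutive polynomials. Each step of the induction
uses both of them at the previous index, so they are proved together. -/
lemma ultraPoly_derivative_relations (lam : ℝ) (n : ℕ) :
    derivative (ultraPoly lam (n + 1)) =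
        X * derivative (ultraPoly lam n) + C ((n : ℝ) + 2 * lam) * ultraPoly lam n ∧
      X * derivative (ultraPoly lam (n + 1)) - derivative (ultraPoly lam n) =
        C ((n : ℝ) + 1) * ultraPoly lam (n + 1) := by
  induction n with
  | zero => simp [ultraPoly, mul_comm]
  | succ n ih =>
    obtain ⟨h1, h2⟩ := ih
    -- The first relation at `n + 1` comes from the derivative of the three-term recurrence.
    have hne : (C ((n : ℝ) + 2)) ≠ (0 : ℝ[X]) := by
      rw [Ne, C_eq_zero]; positivity
    have hr := ultraPoly_add_two lam n
    have hd := congrArg derivative hr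
    simp only [derivative_sub, derivative_mul, derivative_C, derivative_X, zero_mul, zero_add,
      mul_one] at hd
    have e1 : derivative (ultraPoly lam (n + 2)) =
        X * derivative (ultraPoly lam (n + 1))
          + C ((n : ℝ) + 1 + 2 * lam) * ultraPoly lam (n + 1) := by
      apply mul_left_cancel₀ hne
      rw [hd]
      simp only [map_add, map_mul, map_ofNat, map_one] at h2 ⊢
      linear_combination (C (n : ℝ) + 2 * C lam) * h2
    have e2 : X * derivative (ultraPoly lam (n + 2)) - derivative (ultraPoly lam (n + 1)) =
        C ((n : ℝ) + 2) * ultraPoly lam (n + 2) := by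
      rw [hr, e1]
      simp only [map_add, map_mul, map_ofNat, map_one] at h1 h2 ⊢
      linear_combination X * h2 - h1
    constructor
    · push_cast
      exact e1
    · push_cast
      rw [add_assoc (n : ℝ) 1 1, one_add_one_eq_two]
      exact e2

/-- The lowering relation `(1 - x²) C'_{n+1} = -(n+1) x C_{n+1} + (n+2λ) C_n`. -/
lemma one_sub_sq_mul_derivative_ultraPoly (lam : ℝ) (n : ℕ) :
    (1 - X ^ 2) * derivative (ultraPoly lam (n + 1)) =
      -C ((n : ℝ) + 1) * X * ultraPoly lam (n + 1)
        + C ((n : ℝ) + 2 * lam) * ultraPoly lam n := by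
  obtain ⟨h1, h2⟩ := ultraPoly_derivative_relations lam n
  linear_combination h1 - X * h2

/-- The ultraspherical operator `L p = -(1 - x²) p'' + (2λ + 1) x p'`. -/
noncomputable def ultraOperator (lam : ℝ) (p : ℝ[X]) : ℝ[X] :=
  -((1 - X ^ 2) * derivative (derivative p)) + C (2 * lam + 1) * X * derivative p

lemma ultraOperator_ultraPoly (lam : ℝ) (n : ℕ) :
    ultraOperator lam (ultraPoly lam n) = C ((n : ℝ) * (n + 2 * lam)) * ultraPoly lam n := by
  cases n with
  | zero => simp [ultraOperator, ultraPoly]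
  | succ n =>
    have h2 := (ultraPoly_derivative_relations lam n).2
    have h := congrArg derivative (one_sub_sq_mul_derivative_ultraPoly lam n)
    simp only [derivative_sub, derivative_mul, derivative_C, derivative_X, zero_mul, zero_add,
      mul_one, derivative_add, derivative_neg, derivative_one, derivative_X_pow] at h
    unfold ultraOperator
    push_cast
    simp only [map_add, map_mul, map_ofNat, map_one, Nat.cast_ofNat, pow_one,
      Nat.add_one_sub_one] at h h2 ⊢
    linear_combination -h + (C (n : ℝ) + 2 * C lam) * h2

/-- At `x = 1` the lowering relation becomes `(n+1) C_{n+1}(1) = (n+2λ) C_n(1)`. -/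
lemma ultraPoly_eval_one_pos {lam : ℝ} (hlam : 0 < lam) (n : ℕ) :
    0 < (ultraPoly lam n).eval 1 := by
  induction n with
  | zero => simp [ultraPoly]
  | succ n ih =>
    have h := congrArg (eval 1) (one_sub_sq_mul_derivative_ultraPoly lam n)
    simp at h
    have h0 : 0 < ((n : ℝ) + 2 * lam) * (ultraPoly lam n).eval 1 := by positivity
    have h1 : 0 < ((n : ℝ) + 1) * (ultraPoly lam (n + 1)).eval 1 := by linarith
    exact pos_of_mul_pos_right h1 (by positivity)

lemma ultraPoly_ne_zero {lam : ℝ} (hlam : 0 < lam) (n : ℕ) : ultraPoly lam n ≠ 0 := by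
  intro h
  have := ultraPoly_eval_one_pos hlam n
  simp [h] at this

/-- The span is stable under multiplication by `X`, by the three-term recurrence, and
contains `1`. -/
lemma span_ultraPoly {lam : ℝ} (hlam : 0 < lam) :
    Submodule.span ℝ (Set.range (ultraPoly lam)) = ⊤ := by
  set S := Submodule.span ℝ (Set.range (ultraPoly lam)) with hS
  have hmem : ∀ n, ultraPoly lam n ∈ S := fun n => Submodule.subset_span ⟨n, rfl⟩
  have hX : ∀ p ∈ S, X * p ∈ S := by
    intro p hp
    induction hp using Submodule.span_induction with
    | mem x hx =>
      obtain ⟨n, rfl⟩ := hx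
      cases n with
      | zero =>
        have : X * ultraPoly lam 0 = (2 * lam)⁻¹ • ultraPoly lam 1 := by
          rw [eq_inv_smul_iff₀ (by positivity), smul_eq_C_mul, ultraPoly, ultraPoly, mul_one]
        rw [this]
        exact S.smul_mem _ (hmem 1)
      | succ n =>
        have h0 : (2 * ((n : ℝ) + 1 + lam)) ≠ 0 := by positivity
        have : X * ultraPoly lam (n + 1) = (2 * ((n : ℝ) + 1 + lam))⁻¹ •
            (((n : ℝ) + 2) • ultraPoly lam (n + 2) + ((n : ℝ) + 2 * lam) • ultraPoly lam n) := by
          rw [eq_inv_smul_iff₀ h0]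
          simp only [smul_eq_C_mul]
          linear_combination -ultraPoly_add_two lam n
        rw [this]
        exact S.smul_mem _ (S.add_mem (S.smul_mem _ (hmem _)) (S.smul_mem _ (hmem _)))
    | zero => simp
    | add x y _ _ hx hy => rw [mul_add]; exact S.add_mem hx hy
    | smul a x _ hx => rw [mul_smul_comm]; exact S.smul_mem _ hx
  rw [eq_top_iff]
  intro p _
  induction p using Polynomial.induction_on' with
  | add p q hp hq => exact S.add_mem (hp trivial) (hq trivial)
  | monomial n a =>
    rw [← C_mul_X_pow_eq_monomial, ← smul_eq_C_mul]
    refine S.smul_mem _ ?_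
    clear * - hmem hX
    induction n with
    | zero => simpa [ultraPoly] using hmem 0
    | succ n ih => rw [pow_succ']; exact hX _ ih

/-! ### Integrals against the weights `(1 - x²)^β` -/

lemma integrableOn_rpow_mul_one_sub_rpow {a b : ℝ} (ha : 0 < a) (hb : 0 < b) :
    IntegrableOn (fun t : ℝ => t ^ (a - 1) * (1 - t) ^ (b - 1)) (Ioo 0 1) := by
  have h := Complex.betaIntegral_convergent (u := a) (v := b) (by simpa) (by simpa)
  rw [intervalIntegrable_iff_integrableOn_Ioo_of_le (by simp)] at h
  refine (Integrable.re h).congr ?_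
  refine ae_restrict_of_forall_mem measurableSet_Ioo fun x hx => ?_
  have h1 : (0 : ℝ) ≤ 1 - x := by linarith [hx.2]
  simp only [RCLike.re_to_complex]
  have e : ((x : ℂ) ^ ((a : ℂ) - 1) * (1 - (x : ℂ)) ^ ((b : ℂ) - 1)) =
      ((x ^ (a - 1) * (1 - x) ^ (b - 1) : ℝ) : ℂ) := by
    push_cast [Complex.ofReal_cpow hx.1.le, Complex.ofReal_cpow h1]
    rfl
  rw [e, Complex.ofReal_re]

lemma integral_rpow_mul_one_sub_rpow {a b : ℝ} (ha : 0 < a) (hb : 0 < b) :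
    ∫ t in Ioo (0 : ℝ) 1, t ^ (a - 1) * (1 - t) ^ (b - 1) =
      Real.Gamma a * Real.Gamma b / Real.Gamma (a + b) := by
  have h := ProbabilityTheory.beta_eq_betaIntegralReal a b ha hb
  rw [ProbabilityTheory.beta] at h
  rw [h, Complex.betaIntegral, intervalIntegral.integral_of_le (by norm_num),
    integral_Ioc_eq_integral_Ioo, ← Complex.ofReal_re (∫ t in Ioo (0 : ℝ) 1, _)]
  congr 1
  rw [← integral_complex_ofReal]
  refine setIntegral_congr_fun measurableSet_Ioo fun x hx => ?_
  have h1 : (0 : ℝ) ≤ 1 - x := by linarith [hx.2]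
  push_cast [Complex.ofReal_cpow hx.1.le, Complex.ofReal_cpow h1]
  rfl

lemma one_sub_sq_pos {x : ℝ} (hx : x ∈ Ioo (-1 : ℝ) 1) : 0 < 1 - x ^ 2 := by
  nlinarith [hx.1, hx.2]

lemma one_sub_sq_nonneg {x : ℝ} (hx : x ∈ Icc (-1 : ℝ) 1) : 0 ≤ 1 - x ^ 2 := by
  nlinarith [hx.1, hx.2]

/-- The substitution `x = 2 t - 1`, under which `1 - x² = 4 t (1 - t)`. -/
lemma one_sub_sq_rpow_eq {β x : ℝ} (hx : x ∈ Ioo (-1 : ℝ) 1) :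
    (1 - x ^ 2) ^ β = 4 ^ β * ((x / 2 + 1 / 2) ^ β * (1 - (x / 2 + 1 / 2)) ^ β) := by
  have h0 : 0 ≤ x / 2 + 1 / 2 := by linarith [hx.1]
  have h1 : 0 ≤ 1 - (x / 2 + 1 / 2) := by linarith [hx.2]
  rw [← Real.mul_rpow h0 h1, ← Real.mul_rpow (by norm_num) (mul_nonneg h0 h1)]
  congr 1
  ring

lemma integrableOn_weight {β : ℝ} (hβ : -1 < β) :
    IntegrableOn (fun x : ℝ => (1 - x ^ 2) ^ β) (Ioo (-1) 1) := by
  have h := integrableOn_rpow_mul_one_sub_rpow (a := β + 1) (b := β + 1) (by linarith)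
    (by linarith)
  simp only [add_sub_cancel_right] at h
  rw [← intervalIntegrable_iff_integrableOn_Ioo_of_le (by norm_num)] at h
  have h2 := (h.comp_add_right (1 / 2)).comp_mul_right (c := 1 / 2)
  rw [intervalIntegrable_iff_integrableOn_Ioo_of_le (by norm_num)] at h2
  norm_num at h2
  refine (h2.const_mul (4 ^ β)).congr ?_
  refine ae_restrict_of_forall_mem measurableSet_Ioo fun x hx => ?_
  simp only
  rw [one_sub_sq_rpow_eq hx]
  norm_num [div_eq_mul_inv]

lemma integral_weight {β : ℝ} (hβ : -1 < β) :
    ∫ x in Ioo (-1 : ℝ) 1, (1 - x ^ 2) ^ β =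
      2 ^ (2 * β + 1) * (Real.Gamma (β + 1) ^ 2 / Real.Gamma (2 * β + 2)) := by
  have h := integral_rpow_mul_one_sub_rpow (a := β + 1) (b := β + 1) (by linarith)
    (by linarith)
  simp only [add_sub_cancel_right] at h
  rw [setIntegral_congr_fun measurableSet_Ioo (fun x hx => one_sub_sq_rpow_eq hx),
    integral_const_mul, ← integral_Ioc_eq_integral_Ioo,
    ← intervalIntegral.integral_of_le (by norm_num),
    intervalIntegral.integral_comp_div_add
      (f := fun t : ℝ => t ^ β * (1 - t) ^ β) two_ne_zero (1 / 2)]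
  norm_num
  rw [intervalIntegral.integral_of_le (by norm_num), integral_Ioc_eq_integral_Ioo, h,
    Real.rpow_add_one (by norm_num), Real.rpow_mul (by norm_num)]
  norm_num
  ring_nf

lemma integrableOn_mul_weight {β : ℝ} (hβ : -1 < β) {f : ℝ → ℝ} (hf : Continuous f) :
    IntegrableOn (fun x : ℝ => f x * (1 - x ^ 2) ^ β) (Ioo (-1) 1) := by
  obtain ⟨M, hM⟩ := isCompact_Icc.exists_bound_of_continuousOn
    (hf.continuousOn (s := Icc (-1 : ℝ) 1))
  refine (integrableOn_weight hβ).bdd_mul (c := M) hf.aestronglyMeasurable ?_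
  exact ae_restrict_of_forall_mem measurableSet_Ioo fun x hx => hM x (Ioo_subset_Icc_self hx)

/-- The linear functional `p ↦ ∫_{-1}^1 p(x) (1 - x²)^β dx` on polynomials, for `β > -1`. -/
noncomputable def weightInt {β : ℝ} (hβ : -1 < β) : ℝ[X] →ₗ[ℝ] ℝ where
  toFun p := ∫ x in Ioo (-1 : ℝ) 1, p.eval x * (1 - x ^ 2) ^ β
  map_add' p q := by
    rw [← integral_add (integrableOn_mul_weight hβ p.continuous)
      (integrableOn_mul_weight hβ q.continuous)]
    simp only [eval_add, add_mul]
  map_smul' c p := by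
    simp only [eval_smul, smul_eq_mul, mul_assoc, RingHom.id_apply]
    rw [integral_const_mul]

lemma weightInt_apply {β : ℝ} (hβ : -1 < β) (p : ℝ[X]) :
    weightInt hβ p = ∫ x in Ioo (-1 : ℝ) 1, p.eval x * (1 - x ^ 2) ^ β := rfl

lemma weightInt_C_mul {β : ℝ} (hβ : -1 < β) (c : ℝ) (p : ℝ[X]) :
    weightInt hβ (C c * p) = c * weightInt hβ p := by
  rw [← smul_eq_C_mul, map_smul, smul_eq_mul]

lemma weightInt_mono {β : ℝ} (hβ : -1 < β) {p q : ℝ[X]}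
    (h : ∀ x ∈ Icc (-1 : ℝ) 1, p.eval x ≤ q.eval x) : weightInt hβ p ≤ weightInt hβ q := by
  refine setIntegral_mono_on (integrableOn_mul_weight hβ p.continuous)
    (integrableOn_mul_weight hβ q.continuous) measurableSet_Ioo fun x hx => ?_
  exact mul_le_mul_of_nonneg_right (h x (Ioo_subset_Icc_self hx))
    (Real.rpow_nonneg (one_sub_sq_pos hx).le _)

/-- Integration by parts: the integrand is the derivative of `(1 - x²)^(β + 1) r(x)`, which
vanishes at both ends of the interval. -/
lemma weightInt_derivative {β : ℝ} (hβ : -1 < β) (r : ℝ[X]) :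
    weightInt hβ ((1 - X ^ 2) * derivative r - C (2 * (β + 1)) * X * r) = 0 := by
  set q := (1 - X ^ 2) * derivative r - C (2 * (β + 1)) * X * r with hq
  have hint : IntervalIntegrable (fun x : ℝ => q.eval x * (1 - x ^ 2) ^ β) volume (-1) 1 := by
    rw [intervalIntegrable_iff_integrableOn_Ioo_of_le (by norm_num)]
    exact integrableOn_mul_weight hβ q.continuous
  have hcont : Continuous fun x : ℝ => (1 - x ^ 2) ^ (β + 1) * r.eval x := by
    refine Continuous.mul ?_ r.continuous
    exact Continuous.rpow_const (by fun_prop) fun x => Or.inr (by linarith)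
  have hderiv : ∀ x ∈ Ioo (-1 : ℝ) 1,
      HasDerivAt (fun x : ℝ => (1 - x ^ 2) ^ (β + 1) * r.eval x)
        (q.eval x * (1 - x ^ 2) ^ β) x := by
    intro x hx
    have hx0 := one_sub_sq_pos hx
    have h1 : HasDerivAt (fun x : ℝ => 1 - x ^ 2) (-(2 * x)) x := by
      simpa using (hasDerivAt_pow 2 x).const_sub 1
    have h2 := (h1.rpow_const (p := β + 1) (Or.inl hx0.ne')).mul (r.hasDerivAt x)
    convert! h2 using 1
    rw [hq, add_sub_cancel_right, Real.rpow_add_one hx0.ne']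
    simp
    ring
  have h := intervalIntegral.integral_eq_sub_of_hasDerivAt_of_le (by norm_num)
    hcont.continuousOn hderiv hint
  rw [intervalIntegral.integral_of_le (by norm_num), integral_Ioc_eq_integral_Ioo] at h
  rw [weightInt_apply, h]
  have : β + 1 ≠ 0 := by linarith
  simp [Real.zero_rpow this]

/-! ### Orthogonality and spectral multipliers -/

lemma neg_one_lt_sub_half {lam : ℝ} (hlam : 0 < lam) : -1 < lam - 1 / 2 := by linarith

/-- The ultraspherical operator is symmetric, since `(1 - x²)^(λ - 1/2) (p L q - q L p)` is the
derivative of `(1 - x²)^(λ + 1/2) (p' q - p q')`. -/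
lemma weightInt_ultraOperator_mul {lam : ℝ} (hlam : 0 < lam) (p q : ℝ[X]) :
    weightInt (neg_one_lt_sub_half hlam) (ultraOperator lam p * q) =
      weightInt (neg_one_lt_sub_half hlam) (p * ultraOperator lam q) := by
  rw [← sub_eq_zero, ← map_sub, ← neg_eq_zero, ← map_neg]
  convert weightInt_derivative (neg_one_lt_sub_half hlam)
    (derivative p * q - p * derivative q) using 2
  have h : 2 * (lam - 1 / 2 + 1) = 2 * lam + 1 := by ring
  rw [h]
  simp only [ultraOperator, derivative_sub, derivative_mul]
  ring

lemma weightInt_ultraPoly_mul_ultraPoly {lam : ℝ} (hlam : 0 < lam) {m n : ℕ} (hmn : m ≠ n) :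
    weightInt (neg_one_lt_sub_half hlam) (ultraPoly lam m * ultraPoly lam n) = 0 := by
  have h := weightInt_ultraOperator_mul hlam (ultraPoly lam m) (ultraPoly lam n)
  rw [ultraOperator_ultraPoly, ultraOperator_ultraPoly, mul_assoc,
    mul_left_comm (ultraPoly lam m) (C _), weightInt_C_mul, weightInt_C_mul] at h
  have h2 : ((m : ℝ) - n) * (m + n + 2 * lam) *
      weightInt (neg_one_lt_sub_half hlam) (ultraPoly lam m * ultraPoly lam n) = 0 := by
    linear_combination h
  have h3 : ((m : ℝ) - n) ≠ 0 := sub_ne_zero.2 (by exact_mod_cast hmn)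
  have h4 : ((m : ℝ) + n + 2 * lam) ≠ 0 := by positivity
  simpa [h3, h4] using h2

lemma weightInt_mul_self_pos {β : ℝ} (hβ : -1 < β) {p : ℝ[X]} (hp : p ≠ 0) :
    0 < weightInt hβ (p * p) := by
  rw [weightInt_apply, setIntegral_pos_iff_support_of_nonneg_ae]
  · have hsub : Ioo (-1 : ℝ) 1 \ {x | p.IsRoot x} ⊆
        (Function.support fun x : ℝ => (p * p).eval x * (1 - x ^ 2) ^ β) ∩ Ioo (-1 : ℝ) 1 := by
      rintro x ⟨hx, hr⟩
      refine ⟨?_, hx⟩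
      have := (Real.rpow_pos_of_pos (one_sub_sq_pos hx) β).ne'
      simp only [Function.mem_support, eval_mul]
      exact mul_ne_zero (mul_ne_zero hr hr) this
    refine lt_of_lt_of_le ?_ (measure_mono hsub)
    rw [measure_sdiff_null ((Polynomial.finite_setOfPred_isRoot hp).measure_zero _)]
    simp
  · refine ae_restrict_of_forall_mem measurableSet_Ioo fun x hx => ?_
    simp only [Pi.zero_apply, eval_mul]
    exact mul_nonneg (mul_self_nonneg _) (Real.rpow_nonneg (one_sub_sq_pos hx).le _)
  · exact integrableOn_mul_weight hβ (p * p).continuous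

/-- The ultraspherical polynomials as a basis of the space of polynomials. -/
noncomputable def ultraPolyBasis {lam : ℝ} (hlam : 0 < lam) : Module.Basis ℕ ℝ ℝ[X] :=
  Module.Basis.mk (v := ultraPoly lam)
    (by
      rw [linearIndependent_iff']
      intro s g hg i hi
      have h := congrArg (fun p => weightInt (neg_one_lt_sub_half hlam) (p * ultraPoly lam i)) hg
      simp only [Finset.sum_mul, map_sum, zero_mul, map_zero, smul_mul_assoc, map_smul,
        smul_eq_mul] at h
      rw [Finset.sum_eq_single i
        (fun j _ hj => by rw [weightInt_ultraPoly_mul_ultraPoly hlam hj, mul_zero])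
        (fun h' => absurd hi h')] at h
      exact (mul_eq_zero.1 h).resolve_right
        (weightInt_mul_self_pos _ (ultraPoly_ne_zero hlam i)).ne')
    (span_ultraPoly hlam).ge

lemma ultraPolyBasis_apply {lam : ℝ} (hlam : 0 < lam) (n : ℕ) :
    ultraPolyBasis hlam n = ultraPoly lam n := by
  simp [ultraPolyBasis]

lemma sum_repr_smul_ultraPoly {lam : ℝ} (hlam : 0 < lam) (p : ℝ[X]) :
    (((ultraPolyBasis hlam).repr p).sum fun n c => c • ultraPoly lam n) = p := by
  have h := (ultraPolyBasis hlam).linearCombination_repr p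
  rw [Finsupp.linearCombination_apply] at h
  simpa only [ultraPolyBasis_apply] using h

lemma eval_eq_sum_ultraPoly {lam : ℝ} (hlam : 0 < lam) (p : ℝ[X]) (y : ℝ) :
    p.eval y = ∑ n ∈ ((ultraPolyBasis hlam).repr p).support,
      (ultraPolyBasis hlam).repr p n * (ultraPoly lam n).eval y := by
  conv_lhs => rw [← sum_repr_smul_ultraPoly hlam p]
  simp only [Finsupp.sum, eval_finsetSum, eval_smul, smul_eq_mul]

lemma ultraPoly_induction {lam : ℝ} (hlam : 0 < lam) {P : ℝ[X] → Prop}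
    (basis : ∀ n, P (ultraPoly lam n)) (add : ∀ p q, P p → P q → P (p + q))
    (smul : ∀ (c : ℝ) p, P p → P (c • p)) (p : ℝ[X]) : P p := by
  have hp : p ∈ Submodule.span ℝ (Set.range (ultraPoly lam)) := by
    rw [span_ultraPoly hlam]; trivial
  induction hp using Submodule.span_induction with
  | mem x hx => obtain ⟨n, rfl⟩ := hx; exact basis n
  | zero => simpa using smul 0 _ (basis 0)
  | add x y _ _ hx hy => exact add x y hx hy
  | smul a x _ hx => exact smul a x hx

/-- The operator on polynomials that multiplies the component along `C_n^λ` by `τ n`. -/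
noncomputable def ultraMult {lam : ℝ} (hlam : 0 < lam) (τ : ℕ → ℝ) : ℝ[X] →ₗ[ℝ] ℝ[X] :=
  (ultraPolyBasis hlam).constr ℝ fun n => τ n • ultraPoly lam n

lemma ultraMult_ultraPoly {lam : ℝ} (hlam : 0 < lam) (τ : ℕ → ℝ) (n : ℕ) :
    ultraMult hlam τ (ultraPoly lam n) = τ n • ultraPoly lam n := by
  rw [ultraMult]
  conv_lhs => rw [← ultraPolyBasis_apply hlam, Module.Basis.constr_basis]

lemma ultraMult_apply {lam : ℝ} (hlam : 0 < lam) (τ : ℕ → ℝ) (p : ℝ[X]) :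
    ultraMult hlam τ p = ((ultraPolyBasis hlam).repr p).sum
      fun n b => (τ n * b) • ultraPoly lam n := by
  rw [ultraMult, Module.Basis.constr_apply]
  simp only [smul_smul, mul_comm]

lemma weightInt_ultraMult_mul {lam : ℝ} (hlam : 0 < lam) (τ : ℕ → ℝ) (p q : ℝ[X]) :
    weightInt (neg_one_lt_sub_half hlam) (ultraMult hlam τ p * q) =
      weightInt (neg_one_lt_sub_half hlam) (p * ultraMult hlam τ q) := by
  induction p using ultraPoly_induction hlam with
  | add p₁ p₂ h₁ h₂ => simp only [map_add, add_mul, h₁, h₂]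
  | smul c p h => simp only [map_smul, smul_mul_assoc, h]
  | basis m =>
    induction q using ultraPoly_induction hlam with
    | add q₁ q₂ h₁ h₂ => simp only [map_add, mul_add, h₁, h₂]
    | smul c q h => simp only [map_smul, mul_smul_comm, h]
    | basis n =>
      rw [ultraMult_ultraPoly, ultraMult_ultraPoly, smul_mul_assoc, mul_smul_comm, map_smul,
        map_smul]
      by_cases hmn : m = n
      · rw [hmn]
      · rw [weightInt_ultraPoly_mul_ultraPoly hlam hmn, smul_zero, smul_zero]

/-- The quadratic form of a multiplier is diagonal in the basis `C_n^λ`. -/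
lemma weightInt_mul_ultraMult_self {lam : ℝ} (hlam : 0 < lam) (τ : ℕ → ℝ) (p : ℝ[X]) :
    weightInt (neg_one_lt_sub_half hlam) (p * ultraMult hlam τ p) =
      ((ultraPolyBasis hlam).repr p).sum fun n b =>
        τ n * b ^ 2 *
          weightInt (neg_one_lt_sub_half hlam) (ultraPoly lam n * ultraPoly lam n) := by
  set b := (ultraPolyBasis hlam).repr p with hb
  have hp : p = b.sum fun n c => c • ultraPoly lam n := (sum_repr_smul_ultraPoly hlam p).symm
  rw [ultraMult_apply, ← hb]
  conv_lhs => rw [hp]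
  simp only [Finsupp.sum, Finset.sum_mul, Finset.mul_sum, map_sum, smul_mul_assoc,
    mul_smul_comm, map_smul, smul_eq_mul]
  refine Finset.sum_congr rfl fun m hm => ?_
  rw [Finset.sum_eq_single m
    (fun n _ hn => by rw [weightInt_ultraPoly_mul_ultraPoly hlam hn]; simp)
    (fun h' => absurd hm h')]
  ring

/-! ### Moments of the powers of `1 - x²` -/

lemma weightInt_ultraPoly_one {β : ℝ} (hβ : -1 < β) (lam : ℝ) :
    weightInt hβ (ultraPoly lam 1) = 0 := by
  have h := weightInt_derivative hβ 1
  rw [derivative_one, mul_zero, zero_sub, mul_one, map_neg, neg_eq_zero, weightInt_C_mul] at h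
  rw [ultraPoly, weightInt_C_mul,
    (mul_eq_zero.1 h).resolve_left (mul_ne_zero two_ne_zero (by linarith)), mul_zero]

/-- The two-step recurrence of the moments: the integral of `x C_{n+1}` is eliminated between the
three-term recurrence and the lowering relation integrated by parts. -/
lemma weightInt_ultraPoly_add_two {β : ℝ} (hβ : -1 < β) (lam : ℝ) (n : ℕ) :
    ((n : ℝ) + 2) * (n + 2 * β + 3) * weightInt hβ (ultraPoly lam (n + 2)) =
      (n + 2 * lam) * (n + 2 * lam - 2 * β - 1) * weightInt hβ (ultraPoly lam n) := by
  have h := weightInt_derivative hβ (ultraPoly lam (n + 1))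
  rw [one_sub_sq_mul_derivative_ultraPoly, map_sub, map_add, neg_mul, neg_mul, map_neg, mul_assoc,
    mul_assoc, weightInt_C_mul, weightInt_C_mul, weightInt_C_mul] at h
  have hr := congrArg (weightInt hβ) (ultraPoly_add_two lam n)
  rw [map_sub, mul_assoc, weightInt_C_mul, weightInt_C_mul, weightInt_C_mul] at hr
  linear_combination ((n : ℝ) + 2 * β + 3) * hr - 2 * ((n : ℝ) + 1 + lam) * h

/-- The reciprocal of the spectral multiplier of `A_σ^λ`. -/
noncomputable def ultraInvMultiplier (sigma lam : ℝ) (n : ℕ) : ℝ :=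
  Real.Gamma ((n : ℝ) + lam + (1 - sigma) / 2) / Real.Gamma ((n : ℝ) + lam + (1 + sigma) / 2)

/-- Integrability at `±1` of `(1 - x²)^(-(2λ+1+σ)/4)` against `μ_λ`. -/
lemma neg_one_lt_exponent_sub {lam sigma : ℝ} (hlam : 0 < lam) (h1 : sigma < 1) :
    -1 < lam / 2 - 3 / 4 - sigma / 4 := by linarith

/-- Integrability at `±1` of `(1 - x²)^(-(2λ+1-σ)/4)` against `μ_λ`. -/
lemma neg_one_lt_exponent_add {lam sigma : ℝ} (hlam : 0 < lam) (h0 : 0 < sigma) :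
    -1 < lam / 2 - 3 / 4 + sigma / 4 := by linarith

lemma ultraInvMultiplier_add_two {lam sigma : ℝ} (hlam : 0 < lam) (h0 : 0 < sigma)
    (h1 : sigma < 1) (n : ℕ) :
    ((n : ℝ) + lam + (1 + sigma) / 2) * (n + lam + (3 + sigma) / 2) *
        ultraInvMultiplier sigma lam (n + 2) =
      (n + lam + (1 - sigma) / 2) * (n + lam + (3 - sigma) / 2) *
        ultraInvMultiplier sigma lam n := by
  have key : ∀ s : ℝ, 0 < (n : ℝ) + lam + (1 + s) / 2 →
      Real.Gamma (((n + 2 : ℕ) : ℝ) + lam + (1 + s) / 2) =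
        (n + lam + (3 + s) / 2) * ((n + lam + (1 + s) / 2) *
          Real.Gamma ((n : ℝ) + lam + (1 + s) / 2)) := by
    intro s hs
    rw [← Real.Gamma_add_one hs.ne',
      show (n : ℝ) + lam + (3 + s) / 2 = n + lam + (1 + s) / 2 + 1 by ring,
      ← Real.Gamma_add_one (by linarith)]
    congr 1
    push_cast
    ring
  have hp : 0 < (n : ℝ) + lam + (1 + sigma) / 2 := by positivity
  have hn : 0 < (n : ℝ) + lam + (1 - sigma) / 2 := by
    have : (0 : ℝ) ≤ n := n.cast_nonneg
    linarith
  have k1 := key sigma hp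
  have k2 := key (-sigma) (by simpa only [sub_eq_add_neg] using hn)
  simp only [← sub_eq_add_neg] at k2
  unfold ultraInvMultiplier
  rw [k1, k2]
  have := (Real.Gamma_pos_of_pos hp).ne'
  have h3 : 0 < (n : ℝ) + lam + (3 + sigma) / 2 := by positivity
  field_simp

lemma ultraHardyConst_pos {lam sigma : ℝ} (hlam : 0 < lam) (h0 : 0 < sigma) (h1 : sigma < 1) :
    0 < ultraHardyConst sigma lam := by
  have a : 0 < Real.Gamma (lam / 2 + (1 + sigma) / 4) := Real.Gamma_pos_of_pos (by positivity)
  have b : 0 < Real.Gamma (lam / 2 + (1 - sigma) / 4) := Real.Gamma_pos_of_pos (by linarith)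
  unfold ultraHardyConst
  positivity

/-- The equality case of the Hardy inequality, tested on the ultraspherical polynomials: the
inverse of `A_σ^λ` maps `(1 - x²)^(-(2λ+1+σ)/4)` to the multiple by `Q⁻¹` of
`(1 - x²)^(-(2λ+1-σ)/4)`. -/
lemma ultraHardyConst_mul_weightInt_ultraPoly {lam sigma : ℝ} (hlam : 0 < lam) (h0 : 0 < sigma)
    (h1 : sigma < 1) (n : ℕ) :
    ultraHardyConst sigma lam * (ultraInvMultiplier sigma lam n *
        weightInt (neg_one_lt_exponent_sub hlam h1) (ultraPoly lam n)) =
      weightInt (neg_one_lt_exponent_add hlam h0) (ultraPoly lam n) := by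
  induction n using Nat.twoStepInduction with
  | zero =>
    have a : 0 < Real.Gamma (lam / 2 + (1 + sigma) / 4) := Real.Gamma_pos_of_pos (by positivity)
    have b : 0 < Real.Gamma (lam / 2 + (1 - sigma) / 4) := Real.Gamma_pos_of_pos (by linarith)
    have c : 0 < Real.Gamma (lam + (1 + sigma) / 2) := Real.Gamma_pos_of_pos (by positivity)
    have d : 0 < Real.Gamma (lam + (1 - sigma) / 2) := Real.Gamma_pos_of_pos (by linarith)
    have e : ∀ {β : ℝ} (hβ : -1 < β), weightInt hβ (ultraPoly lam 0) =
        2 ^ (2 * β + 1) * (Real.Gamma (β + 1) ^ 2 / Real.Gamma (2 * β + 2)) := by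
      intro β hβ
      rw [← integral_weight hβ, weightInt_apply]
      simp [ultraPoly]
    rw [e, e, ultraHardyConst, ultraInvMultiplier]
    rw [show lam / 2 - 3 / 4 - sigma / 4 + 1 = lam / 2 + (1 - sigma) / 4 by ring,
      show lam / 2 - 3 / 4 + sigma / 4 + 1 = lam / 2 + (1 + sigma) / 4 by ring,
      show 2 * (lam / 2 - 3 / 4 - sigma / 4) + 2 = lam + (1 - sigma) / 2 by ring,
      show 2 * (lam / 2 - 3 / 4 + sigma / 4) + 2 = lam + (1 + sigma) / 2 by ring,
      show 2 * (lam / 2 - 3 / 4 + sigma / 4) + 1 =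
        sigma + (2 * (lam / 2 - 3 / 4 - sigma / 4) + 1) by ring,
      Real.rpow_add two_pos sigma, Nat.cast_zero, zero_add]
    generalize Real.Gamma (lam + (1 - sigma) / 2) = G at d ⊢
    generalize Real.Gamma (lam / 2 + (1 - sigma) / 4) = H at b ⊢
    generalize (2 : ℝ) ^ (2 * (lam / 2 - 3 / 4 - sigma / 4) + 1) = K
    field_simp
  | one => rw [weightInt_ultraPoly_one, weightInt_ultraPoly_one, mul_zero, mul_zero]
  | more n ih _ =>
    have hm := ultraInvMultiplier_add_two hlam h0 h1 n
    have hA := weightInt_ultraPoly_add_two (neg_one_lt_exponent_sub hlam h1) lam n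
    have hB := weightInt_ultraPoly_add_two (neg_one_lt_exponent_add hlam h0) lam n
    have hn : (0 : ℝ) ≤ n := n.cast_nonneg
    set Q := ultraHardyConst sigma lam
    set A := weightInt (neg_one_lt_exponent_sub hlam h1) (ultraPoly lam n)
    set B := weightInt (neg_one_lt_exponent_add hlam h0) (ultraPoly lam n)
    set A' := weightInt (neg_one_lt_exponent_sub hlam h1) (ultraPoly lam (n + 2))
    set B' := weightInt (neg_one_lt_exponent_add hlam h0) (ultraPoly lam (n + 2))
    set t := ultraInvMultiplier sigma lam n
    set t' := ultraInvMultiplier sigma lam (n + 2)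
    have p1 : (n : ℝ) + lam + (1 + sigma) / 2 ≠ 0 := by positivity
    have p2 : (n : ℝ) + lam + (3 + sigma) / 2 ≠ 0 := by positivity
    have p3 : (n : ℝ) + lam + (3 - sigma) / 2 ≠ 0 := ne_of_gt (by linarith)
    have p4 : (n : ℝ) + 2 ≠ 0 := by positivity
    have hm' : t' = (n + lam + (1 - sigma) / 2) * (n + lam + (3 - sigma) / 2) * t /
        ((n + lam + (1 + sigma) / 2) * (n + lam + (3 + sigma) / 2)) := by
      rw [eq_div_iff (mul_ne_zero p1 p2)]
      linear_combination hm
    have hA' : A' = (n + 2 * lam) * (n + lam + (1 + sigma) / 2) * A /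
        ((n + 2) * (n + lam + (3 - sigma) / 2)) := by
      rw [eq_div_iff (mul_ne_zero p4 p3)]
      linear_combination hA
    have hB' : B' = (n + 2 * lam) * (n + lam + (1 - sigma) / 2) * B /
        ((n + 2) * (n + lam + (3 + sigma) / 2)) := by
      rw [eq_div_iff (mul_ne_zero p4 p2)]
      linear_combination hB
    rw [hm', hA', hB', ← ih]
    generalize (n : ℝ) + lam + (3 - sigma) / 2 = y at p3 ⊢
    field_simp

/-! ### Positivity of the inverse of `A_σ^λ` on polynomials -/

lemma IsLocalMin.deriv_deriv_nonneg {f : ℝ → ℝ} {a : ℝ} (h : IsLocalMin f a)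
    (hc : ContinuousAt f a) : 0 ≤ deriv (deriv f) a := by
  by_contra! hneg
  -- By the second derivative test `a` is also a local maximum, so `f` is constant near `a`.
  have hmax := isLocalMax_of_deriv_deriv_neg hneg h.deriv_eq_zero hc
  have heq : f =ᶠ[𝓝 a] fun _ => f a := by
    filter_upwards [h, hmax] with x h1 h2 using le_antisymm h2 h1
  have h2 : deriv (deriv f) a = 0 := by
    rw [(heq.deriv).deriv_eq]
    simp
  exact hneg.ne h2

/-- The minimum principle: `L p ≤ 0` at a minimum of `p` on `[-1, 1]`. At the endpoints, where
the second-order term vanishes, this is the sign of the one-sided derivative. -/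
lemma ultraOperator_eval_nonpos {lam : ℝ} (hlam : 0 < lam) {p : ℝ[X]} {a : ℝ}
    (ha : a ∈ Icc (-1 : ℝ) 1) (hmin : ∀ x ∈ Icc (-1 : ℝ) 1, p.eval a ≤ p.eval x) :
    (ultraOperator lam p).eval a ≤ 0 := by
  have hd := p.hasDerivAt a
  simp only [ultraOperator, eval_add, eval_neg, eval_mul, eval_sub, eval_one, eval_pow, eval_X,
    eval_C]
  rcases eq_or_lt_of_le ha.1 with h | h
  · have hs := hasDerivAt_iff_tendsto_slope_left_right.1 hd |>.2
    have h0 : 0 ≤ (derivative p).eval a := by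
      refine ge_of_tendsto hs ?_
      filter_upwards [Ioo_mem_nhdsGT (show a < 1 by linarith)] with x hx
      rw [slope_def_field]
      exact div_nonneg (sub_nonneg.2 (hmin x ⟨by linarith [hx.1], hx.2.le⟩))
        (by linarith [hx.1])
    rw [← h] at h0 ⊢
    nlinarith
  rcases eq_or_lt_of_le ha.2 with h' | h'
  · have hs := hasDerivAt_iff_tendsto_slope_left_right.1 hd |>.1
    have h0 : (derivative p).eval a ≤ 0 := by
      refine le_of_tendsto hs ?_
      filter_upwards [Ioo_mem_nhdsLT (show -1 < a by linarith)] with x hx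
      rw [slope_def_field]
      exact div_nonpos_of_nonneg_of_nonpos
        (sub_nonneg.2 (hmin x ⟨hx.1.le, by linarith [hx.2]⟩)) (by linarith [hx.2])
    rw [h'] at h0 ⊢
    nlinarith
  have hloc : IsLocalMin (fun x => p.eval x) a := by
    filter_upwards [Icc_mem_nhds h h'] with x hx using hmin x hx
  have h1 : (derivative p).eval a = 0 := by
    rw [← Polynomial.deriv]; exact hloc.deriv_eq_zero
  have h2 : 0 ≤ (derivative (derivative p)).eval a := by
    have h3 := hloc.deriv_deriv_nonneg p.continuous.continuousAt
    rwa [show (deriv fun x => p.eval x) = fun x => (derivative p).eval x from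
      funext fun x => p.deriv, Polynomial.deriv] at h3
  have h4 := mul_nonneg (one_sub_sq_nonneg ha) h2
  rw [h1]
  linarith

/-- The Poisson semigroup `e^{-s √(L + λ²)}` preserves positivity on `[-1, 1]`. The function
`v(x, s) = ∑ e^{-(n+λ)s} b_n C_n(x)` solves `∂²v/∂s² = L v + λ² v` and vanishes as `s → ∞`; at a
negative minimum the left side is `≥ 0` and the right side is `< 0`. -/
lemma sum_exp_mul_ultraPoly_nonneg {lam : ℝ} (hlam : 0 < lam) (I : Finset ℕ) (b : ℕ → ℝ)
    (hb : ∀ x ∈ Icc (-1 : ℝ) 1, 0 ≤ ∑ n ∈ I, b n * (ultraPoly lam n).eval x)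
    {x s : ℝ} (hx : x ∈ Icc (-1 : ℝ) 1) (hs : 0 ≤ s) :
    0 ≤ ∑ n ∈ I, Real.exp (-((n : ℝ) + lam) * s) * (b n * (ultraPoly lam n).eval x) := by
  set v : ℝ → ℝ → ℝ := fun x s =>
    ∑ n ∈ I, Real.exp (-((n : ℝ) + lam) * s) * (b n * (ultraPoly lam n).eval x) with hv
  change 0 ≤ v x s
  by_contra! hneg
  have hcont : Continuous fun z : ℝ × ℝ => v z.1 z.2 := by
    refine continuous_finsetSum _ fun n _ => ?_
    have : Continuous fun z : ℝ × ℝ => (ultraPoly lam n).eval z.1 :=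
      (ultraPoly lam n).continuous.comp continuous_fst
    fun_prop
  obtain ⟨M, hM⟩ := isCompact_Icc.exists_bound_of_continuousOn
    (f := fun x => ∑ n ∈ I, |b n * (ultraPoly lam n).eval x|) (s := Icc (-1 : ℝ) 1)
    (continuous_finsetSum _ fun n _ =>
      ((ultraPoly lam n).continuous.const_mul (b n)).abs).continuousOn
  have hdecay : ∀ y ∈ Icc (-1 : ℝ) 1, ∀ r, 0 ≤ r → |v y r| ≤ Real.exp (-(lam * r)) * M := by
    intro y hy r hr
    refine (Finset.abs_sum_le_sum_abs _ _).trans ?_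
    refine le_trans ?_ (mul_le_mul_of_nonneg_left ((le_abs_self _).trans (hM y hy))
      (Real.exp_nonneg _))
    rw [Finset.mul_sum]
    refine Finset.sum_le_sum fun n _ => ?_
    rw [abs_mul, abs_of_pos (Real.exp_pos _)]
    refine mul_le_mul_of_nonneg_right (Real.exp_le_exp.2 ?_) (abs_nonneg _)
    have : 0 ≤ (n : ℝ) * r := by positivity
    linarith
  -- Beyond the height `S` the function `v` stays above its value at `(x, s)`, so its minimum over
  -- `[-1, 1] × [0, S]` is attained at an interior height.
  obtain ⟨S, hS1, hS2⟩ : ∃ S, Real.exp (-(lam * S)) * M < -v x s ∧ s < S := by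
    have ht : Tendsto (fun S : ℝ => Real.exp (-(lam * S)) * M) atTop (𝓝 (0 * M)) :=
      (Real.tendsto_exp_neg_atTop_nhds_zero.comp
        (tendsto_id.const_mul_atTop hlam)).mul_const M
    rw [zero_mul] at ht
    exact ((ht.eventually_lt_const (by linarith)).and (eventually_gt_atTop s)).exists
  obtain ⟨⟨a, r⟩, ⟨ha, hr⟩, hmin⟩ := (isCompact_Icc.prod isCompact_Icc).exists_isMinOn
    (s := Icc (-1 : ℝ) 1 ×ˢ Icc 0 S) ⟨(x, s), hx, hs, hS2.le⟩ hcont.continuousOn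
  have hmin' : ∀ y ∈ Icc (-1 : ℝ) 1, ∀ q ∈ Icc 0 S, v a r ≤ v y q := fun y hy q hq =>
    hmin (show (y, q) ∈ Icc (-1 : ℝ) 1 ×ˢ Icc 0 S from ⟨hy, hq⟩)
  have har : v a r < 0 := (hmin' x hx s ⟨hs, hS2.le⟩).trans_lt hneg
  have hr0 : 0 < r := by
    refine lt_of_le_of_ne hr.1 fun h0 => ?_
    have := hb a ha
    rw [← h0] at har
    simp only [hv, mul_zero, Real.exp_zero, one_mul] at har
    linarith
  have hrS : r < S := by
    refine lt_of_le_of_ne hr.2 fun h0 => ?_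
    have h1 := hmin' x hx s ⟨hs, hS2.le⟩
    have h2 := neg_abs_le (v a r)
    have h3 := hdecay a ha r hr.1
    rw [h0] at h1 h2 h3
    linarith
  have hloc : IsLocalMin (fun q => v a q) r := by
    filter_upwards [Icc_mem_nhds hr0 hrS] with q hq using hmin' a ha q hq
  have hd : ∀ (k : ℕ → ℝ) (q : ℝ),
      HasDerivAt (fun q => ∑ n ∈ I, Real.exp (-((n : ℝ) + lam) * q) * k n)
        (∑ n ∈ I, Real.exp (-((n : ℝ) + lam) * q) * (-((n : ℝ) + lam) * k n)) q := by
    intro k q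
    refine HasDerivAt.fun_sum fun n _ => ?_
    have h1 : HasDerivAt (fun q : ℝ => -((n : ℝ) + lam) * q) (-((n : ℝ) + lam)) q := by
      simpa using (hasDerivAt_id q).const_mul (-((n : ℝ) + lam))
    convert! h1.exp.mul_const (k n) using 1
    ring
  have hss := hloc.deriv_deriv_nonneg
    (hcont.comp (continuous_const.prodMk continuous_id)).continuousAt
  rw [show deriv (fun q => v a q) = fun q => ∑ n ∈ I, Real.exp (-((n : ℝ) + lam) * q) *
      (-((n : ℝ) + lam) * (b n * (ultraPoly lam n).eval a)) from
      funext fun q => (hd _ q).deriv, (hd _ r).deriv] at hss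
  set p : ℝ[X] := ∑ n ∈ I, (Real.exp (-((n : ℝ) + lam) * r) * b n) • ultraPoly lam n with hp
  have hpv : ∀ y, p.eval y = v y r := fun y => by
    simp only [hp, hv, eval_finsetSum, eval_smul, smul_eq_mul, mul_assoc]
  have hL := ultraOperator_eval_nonpos hlam (p := p) ha fun y hy => by
    rw [hpv, hpv]; exact hmin' y hy r hr
  have hLp : ultraOperator lam p = ∑ n ∈ I, (Real.exp (-((n : ℝ) + lam) * r) * b n) •
      (C ((n : ℝ) * (n + 2 * lam)) * ultraPoly lam n) := by
    simp_rw [← ultraOperator_ultraPoly]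
    simp only [ultraOperator, hp, derivative_sum, derivative_smul, Finset.mul_sum,
      ← Finset.sum_neg_distrib, ← Finset.sum_add_distrib, mul_smul_comm, smul_add, smul_neg]
  rw [hLp] at hL
  simp only [eval_finsetSum, eval_smul, smul_eq_mul, eval_mul, eval_C] at hL
  have hid : ∑ n ∈ I, Real.exp (-((n : ℝ) + lam) * r) *
      (-((n : ℝ) + lam) * (-((n : ℝ) + lam) * (b n * (ultraPoly lam n).eval a))) =
      (∑ n ∈ I, Real.exp (-((n : ℝ) + lam) * r) * b n *
        ((n : ℝ) * (n + 2 * lam) * (ultraPoly lam n).eval a)) + lam ^ 2 * v a r := by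
    rw [hv, Finset.mul_sum, ← Finset.sum_add_distrib]
    exact Finset.sum_congr rfl fun n _ => by ring
  have hlast : lam ^ 2 * v a r < 0 := mul_neg_of_pos_of_neg (by positivity) har
  linarith

/-- The inverse of `A_σ^λ` is the integral of the Poisson semigroup `e^{-s √(L + λ²)}`, with
`t = e^{-s}`, against the positive density of Euler's Beta integral. -/
lemma ultraMult_ultraInvMultiplier_nonneg {lam sigma : ℝ} (hlam : 0 < lam) (h0 : 0 < sigma)
    (h1 : sigma < 1) {p : ℝ[X]} (hp : ∀ x ∈ Icc (-1 : ℝ) 1, 0 ≤ p.eval x) {x : ℝ}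
    (hx : x ∈ Icc (-1 : ℝ) 1) :
    0 ≤ (ultraMult hlam (ultraInvMultiplier sigma lam) p).eval x := by
  have hG := Real.Gamma_pos_of_pos h0
  set b := (ultraPolyBasis hlam).repr p with hb
  have hpb : ∀ y, p.eval y = ∑ n ∈ b.support, b n * (ultraPoly lam n).eval y :=
    eval_eq_sum_ultraPoly hlam p
  have ha : ∀ n : ℕ, 0 < (n : ℝ) + lam + (1 - sigma) / 2 := fun n => by
    have : (0 : ℝ) ≤ n := n.cast_nonneg
    linarith
  have hint : ∀ n : ℕ, IntegrableOn (fun t : ℝ =>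
      t ^ ((n : ℝ) + lam + (1 - sigma) / 2 - 1) * (1 - t) ^ (sigma - 1) *
        (b n * (ultraPoly lam n).eval x)) (Ioo 0 1) := fun n =>
    (integrableOn_rpow_mul_one_sub_rpow (ha n) h0).mul_const _
  have hval : ∀ n : ℕ, Real.Gamma sigma * (ultraInvMultiplier sigma lam n * b n *
      (ultraPoly lam n).eval x) = ∫ t in Ioo (0 : ℝ) 1,
        t ^ ((n : ℝ) + lam + (1 - sigma) / 2 - 1) * (1 - t) ^ (sigma - 1) *
          (b n * (ultraPoly lam n).eval x) := by
    intro n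
    rw [integral_mul_const, integral_rpow_mul_one_sub_rpow (ha n) h0, ultraInvMultiplier,
      show (n : ℝ) + lam + (1 - sigma) / 2 + sigma = n + lam + (1 + sigma) / 2 by ring]
    ring
  refine nonneg_of_mul_nonneg_left (b := Real.Gamma sigma) ?_ hG
  rw [ultraMult_apply, ← hb]
  simp only [Finsupp.sum, eval_finsetSum, eval_smul, smul_eq_mul]
  rw [mul_comm, Finset.mul_sum, Finset.sum_congr rfl fun n _ => hval n,
    ← integral_finsetSum _ fun n _ => hint n]
  refine setIntegral_nonneg measurableSet_Ioo fun t ht => ?_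
  have hpois := sum_exp_mul_ultraPoly_nonneg hlam b.support b
    (fun y hy => by rw [← hpb]; exact hp y hy) hx (s := -Real.log t)
    (by linarith [Real.log_neg ht.1 ht.2])
  have hpos : 0 ≤ t ^ ((1 - sigma) / 2 - 1) * (1 - t) ^ (sigma - 1) :=
    mul_nonneg (Real.rpow_nonneg ht.1.le _) (Real.rpow_nonneg (by linarith [ht.2]) _)
  refine (mul_nonneg hpos hpois).trans_eq ?_
  rw [Finset.mul_sum]
  refine Finset.sum_congr rfl fun n _ => ?_
  rw [show (n : ℝ) + lam + (1 - sigma) / 2 - 1 = ((1 - sigma) / 2 - 1) + (n + lam) by ring,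
    Real.rpow_add ht.1, Real.rpow_def_of_pos ht.1 ((n : ℝ) + lam),
    show -((n : ℝ) + lam) * -Real.log t = Real.log t * (n + lam) by ring]
  ring

/-! ### The Schur test on polynomials -/

lemma ultraHardyConst_mul_weightInt_ultraMult {lam sigma : ℝ} (hlam : 0 < lam) (h0 : 0 < sigma)
    (h1 : sigma < 1) (h : ℝ[X]) :
    ultraHardyConst sigma lam * weightInt (neg_one_lt_exponent_sub hlam h1)
        (ultraMult hlam (ultraInvMultiplier sigma lam) h) =
      weightInt (neg_one_lt_exponent_add hlam h0) h := by
  induction h using ultraPoly_induction hlam with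
  | add p q hp hq => rw [map_add, map_add, map_add, mul_add, hp, hq]
  | smul c p hp => rw [map_smul, map_smul, map_smul, smul_eq_mul, smul_eq_mul, mul_left_comm, hp]
  | basis n =>
    rw [ultraMult_ultraPoly, map_smul, smul_eq_mul]
    exact ultraHardyConst_mul_weightInt_ultraPoly hlam h0 h1 n

/-- The Schur test: expand `T(φ (g - g(x))²)(x) ≥ 0` and integrate against `φ`. -/
lemma weightInt_schur {lam : ℝ} (hlam : 0 < lam) (τ : ℕ → ℝ)
    (hτ : ∀ p : ℝ[X], (∀ x ∈ Icc (-1 : ℝ) 1, 0 ≤ p.eval x) →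
      ∀ x ∈ Icc (-1 : ℝ) 1, 0 ≤ (ultraMult hlam τ p).eval x)
    {φ : ℝ[X]} (hφ : ∀ x ∈ Icc (-1 : ℝ) 1, 0 ≤ φ.eval x) (g : ℝ[X]) :
    weightInt (neg_one_lt_sub_half hlam) (φ * g * ultraMult hlam τ (φ * g)) ≤
      weightInt (neg_one_lt_sub_half hlam) (φ * ultraMult hlam τ (φ * g ^ 2)) := by
  set T := ultraMult hlam τ with hT
  have hsymm : weightInt (neg_one_lt_sub_half hlam) (φ * g ^ 2 * T φ) =
      weightInt (neg_one_lt_sub_half hlam) (φ * T (φ * g ^ 2)) := by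
    rw [hT, ← weightInt_ultraMult_mul, mul_comm]
  have hle : weightInt (neg_one_lt_sub_half hlam) ((2 : ℝ) • (φ * g * T (φ * g))) ≤
      weightInt (neg_one_lt_sub_half hlam) (φ * T (φ * g ^ 2) + φ * g ^ 2 * T φ) := by
    refine weightInt_mono _ fun x hx => ?_
    have hpos := hτ (φ * (g - C (g.eval x)) ^ 2) (fun y hy => by
      simp only [eval_mul, eval_pow]
      exact mul_nonneg (hφ y hy) (sq_nonneg _)) x hx
    have hexp : φ * (g - C (g.eval x)) ^ 2 =
        φ * g ^ 2 - (2 * g.eval x) • (φ * g) + (g.eval x) ^ 2 • φ := by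
      simp only [smul_eq_C_mul, map_mul, map_pow, map_ofNat]
      ring
    rw [hexp, map_add, map_sub, map_smul, map_smul] at hpos
    simp only [eval_add, eval_sub, eval_smul, smul_eq_mul] at hpos
    simp only [eval_add, eval_mul, eval_pow, eval_smul, smul_eq_mul]
    have := mul_nonneg (hφ x hx) hpos
    rw [hT]
    linarith
  rw [map_smul, map_add, hsymm, smul_eq_mul] at hle
  linarith

/-- Multiplication by `φ ≤ (1 - x²)^(-κ)` costs at most `κ` in the exponent of the weight. -/
lemma weightInt_mul_le_weightInt {α β κ : ℝ} (hα : -1 < α) (hβ : -1 < β) (hκ : β + κ = α)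
    {φ h : ℝ[X]} (hφ : ∀ x ∈ Ioo (-1 : ℝ) 1, φ.eval x ≤ (1 - x ^ 2) ^ (-κ))
    (hh : ∀ x ∈ Icc (-1 : ℝ) 1, 0 ≤ h.eval x) :
    weightInt hα (φ * h) ≤ weightInt hβ h := by
  refine setIntegral_mono_on (integrableOn_mul_weight hα (φ * h).continuous)
    (integrableOn_mul_weight hβ h.continuous) measurableSet_Ioo fun x hx => ?_
  have hx0 := one_sub_sq_pos hx
  rw [show β = -κ + α by linarith, Real.rpow_add hx0, eval_mul, mul_comm (eval x φ), mul_assoc]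
  exact mul_le_mul_of_nonneg_left
    (mul_le_mul_of_nonneg_right (hφ x hx) (Real.rpow_nonneg hx0.le _))
    (hh x (Ioo_subset_Icc_self hx))

/-- The Schur test for the inverse of `A_σ^λ` with a polynomial minorant `φ` of its extremal
function `(1 - x²)^(-(2λ+1+σ)/4)`. -/
lemma ultraHardyConst_mul_weightInt_le {lam sigma : ℝ} (hlam : 0 < lam) (h0 : 0 < sigma)
    (h1 : sigma < 1) {φ : ℝ[X]} (hφ : ∀ x ∈ Icc (-1 : ℝ) 1, 0 ≤ φ.eval x)
    (hφ' : ∀ x ∈ Ioo (-1 : ℝ) 1, φ.eval x ≤ (1 - x ^ 2) ^ (-((2 * lam + 1 + sigma) / 4)))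
    (g : ℝ[X]) :
    ultraHardyConst sigma lam * weightInt (neg_one_lt_sub_half hlam)
        (φ * g * ultraMult hlam (ultraInvMultiplier sigma lam) (φ * g)) ≤
      weightInt (neg_one_lt_exponent_add hlam h0) (φ * g ^ 2) := by
  have hτ : ∀ p : ℝ[X], (∀ x ∈ Icc (-1 : ℝ) 1, 0 ≤ p.eval x) → ∀ x ∈ Icc (-1 : ℝ) 1,
      0 ≤ (ultraMult hlam (ultraInvMultiplier sigma lam) p).eval x := fun p hp x hx =>
    ultraMult_ultraInvMultiplier_nonneg hlam h0 h1 hp hx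
  rw [← ultraHardyConst_mul_weightInt_ultraMult hlam h0 h1]
  refine mul_le_mul_of_nonneg_left ?_ (ultraHardyConst_pos hlam h0 h1).le
  refine (weightInt_schur hlam _ hτ hφ g).trans ?_
  refine weightInt_mul_le_weightInt _ _ (by ring) hφ' (hτ _ fun x hx => ?_)
  rw [eval_mul, eval_pow]
  exact mul_nonneg (hφ x hx) (sq_nonneg _)

/-! ### The measure `μ_λ` and the pairing -/

lemma integral_ultraMeasure (lam : ℝ) (f : ℝ → ℝ) :
    ∫ x, f x ∂(ultraMeasure lam) =
      ∫ x in Ioo (-1 : ℝ) 1, f x * (1 - x ^ 2) ^ (lam - 1 / 2) := by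
  rw [ultraMeasure, integral_withDensity_eq_integral_toReal_smul
    (by fun_prop) (ae_of_all _ fun _ => ENNReal.ofReal_lt_top)]
  refine setIntegral_congr_fun measurableSet_Ioo fun x hx => ?_
  simp only [smul_eq_mul]
  rw [ENNReal.toReal_ofReal (Real.rpow_nonneg (one_sub_sq_pos hx).le _), mul_comm]

lemma integral_ultraMeasure_eval {lam : ℝ} (hlam : 0 < lam) (p : ℝ[X]) :
    ∫ x, p.eval x ∂(ultraMeasure lam) = weightInt (neg_one_lt_sub_half hlam) p :=
  integral_ultraMeasure lam _

lemma isFiniteMeasure_ultraMeasure {lam : ℝ} (hlam : 0 < lam) :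
    IsFiniteMeasure (ultraMeasure lam) := by
  refine isFiniteMeasure_withDensity (ne_of_lt ?_)
  exact (integrableOn_weight (neg_one_lt_sub_half hlam)).lintegral_lt_top

lemma ae_ultraMeasure_of_forall_mem {lam : ℝ} {P : ℝ → Prop} (h : ∀ x ∈ Ioo (-1 : ℝ) 1, P x) :
    ∀ᵐ x ∂(ultraMeasure lam), P x :=
  (withDensity_absolutelyContinuous _ _).ae_le (ae_restrict_of_forall_mem measurableSet_Ioo h)

lemma memLp_ultraMeasure {lam : ℝ} (hlam : 0 < lam) {f : ℝ → ℝ} (hf : Continuous f) :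
    MemLp f 2 (ultraMeasure lam) := by
  have := isFiniteMeasure_ultraMeasure hlam
  obtain ⟨M, hM⟩ := isCompact_Icc.exists_bound_of_continuousOn
    (hf.continuousOn (s := Icc (-1 : ℝ) 1))
  exact MemLp.of_bound hf.aestronglyMeasurable M
    (ae_ultraMeasure_of_forall_mem fun x hx => hM x (Ioo_subset_Icc_self hx))

lemma ultraNorm_sq {lam : ℝ} (hlam : 0 < lam) (n : ℕ) :
    ultraNorm lam n ^ 2 =
      weightInt (neg_one_lt_sub_half hlam) (ultraPoly lam n * ultraPoly lam n) := by
  rw [ultraNorm, Real.sq_sqrt (integral_nonneg fun x => sq_nonneg _),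
    ← integral_ultraMeasure_eval hlam]
  simp only [eval_mul, sq]

lemma ultraNorm_pos {lam : ℝ} (hlam : 0 < lam) (n : ℕ) : 0 < ultraNorm lam n := by
  have h := weightInt_mul_self_pos (neg_one_lt_sub_half hlam) (ultraPoly_ne_zero hlam n)
  rw [← ultraNorm_sq hlam] at h
  exact lt_of_le_of_ne (Real.sqrt_nonneg _) fun h0 => by simp [← h0] at h

lemma integral_mul_ultraPoly {lam : ℝ} (hlam : 0 < lam) (u : ℝ → ℝ) (n : ℕ) :
    ∫ x, u x * (ultraPoly lam n).eval x ∂(ultraMeasure lam) =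
      ultraNorm lam n * ultraCoeff lam u n := by
  rw [ultraCoeff, ← integral_const_mul]
  congr 1 with x
  rw [ultraBasis]
  field_simp [(ultraNorm_pos hlam n).ne']

lemma ultraMultiplier_pos {lam sigma : ℝ} (hlam : 0 < lam) (h0 : 0 < sigma) (h1 : sigma < 1)
    (n : ℕ) : 0 < ultraMultiplier sigma lam n := by
  have : (0 : ℝ) ≤ n := n.cast_nonneg
  exact div_pos (Real.Gamma_pos_of_pos (by linarith)) (Real.Gamma_pos_of_pos (by linarith))

lemma ultraInvMultiplier_eq_inv (sigma lam : ℝ) (n : ℕ) :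
    ultraInvMultiplier sigma lam n = (ultraMultiplier sigma lam n)⁻¹ := by
  rw [ultraInvMultiplier, ultraMultiplier, inv_div]

/-- The log-convexity of `Γ` bounds the multiplier by a constant times `(n + λ)^σ`. -/
lemma ultraMultiplier_le {lam sigma : ℝ} (hlam : 0 < lam) (h0 : 0 < sigma) (h1 : sigma < 1)
    (n : ℕ) :
    ultraMultiplier sigma lam n ≤ (1 + 1 / lam) ^ sigma * ((n : ℝ) + lam) ^ sigma := by
  have hn : (0 : ℝ) ≤ n := n.cast_nonneg
  set x := (n : ℝ) + lam + (1 - sigma) / 2 with hx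
  have hx0 : 0 < x := by rw [hx]; linarith
  have hG := Real.Gamma_pos_of_pos hx0
  have h := Real.Gamma_mul_add_mul_le_rpow_Gamma_mul_rpow_Gamma hx0
    (show 0 < x + 1 by linarith) (show 0 < 1 - sigma by linarith) h0 (by ring)
  rw [Real.Gamma_add_one hx0.ne', Real.mul_rpow hx0.le hG.le, mul_left_comm,
    ← Real.rpow_add hG, sub_add_cancel, Real.rpow_one,
    show (1 - sigma) * x + sigma * (x + 1) = n + lam + (1 + sigma) / 2 by rw [hx]; ring] at h
  have h2 : ultraMultiplier sigma lam n ≤ x ^ sigma := by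
    rw [ultraMultiplier, div_le_iff₀ hG]
    exact h
  refine h2.trans ?_
  rw [← Real.mul_rpow (by positivity) (by positivity)]
  refine Real.rpow_le_rpow hx0.le ?_ h0.le
  have : (1 + 1 / lam) * ((n : ℝ) + lam) = n + lam + n / lam + 1 := by
    field_simp
    ring
  have h3 : 0 ≤ (n : ℝ) / lam := by positivity
  rw [this, hx]
  linarith

lemma integral_mul_ultraOpTerm (sigma lam : ℝ) (u v : ℝ → ℝ) (n : ℕ) :
    ∫ x, v x * ultraOpTerm sigma lam u n x ∂(ultraMeasure lam) =
      ultraMultiplier sigma lam n * ultraCoeff lam u n * ultraCoeff lam v n := by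
  rw [ultraCoeff.eq_1 lam v, ← integral_const_mul]
  congr 1 with x
  rw [ultraOpTerm]
  ring

lemma hasSum_ultraPairing {lam sigma : ℝ} (hlam : 0 < lam) (h0 : 0 < sigma) (h1 : sigma < 1)
    {u : ℝ → ℝ} (hu : u ∈ ultraSobolev sigma lam) :
    HasSum (fun n : ℕ => ultraMultiplier sigma lam n * (ultraCoeff lam u n) ^ 2)
      (ultraPairing sigma lam u u) := by
  have hs : Summable fun n : ℕ => ultraMultiplier sigma lam n * (ultraCoeff lam u n) ^ 2 := by
    refine Summable.of_nonneg_of_le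
      (fun n => mul_nonneg (ultraMultiplier_pos hlam h0 h1 n).le (sq_nonneg _)) (fun n => ?_)
      (hu.2.mul_left ((1 + 1 / lam) ^ sigma))
    rw [← mul_assoc]
    exact mul_le_mul_of_nonneg_right (ultraMultiplier_le hlam h0 h1 n) (sq_nonneg _)
  convert hs.hasSum using 1
  refine tsum_congr fun n => ?_
  rw [integral_mul_ultraOpTerm]
  ring

/-- The Cauchy-Schwarz inequality between the quadratic forms of `A_σ^λ` and of its inverse. -/
lemma sq_integral_mul_le_ultraPairing_mul {lam sigma : ℝ} (hlam : 0 < lam) (h0 : 0 < sigma)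
    (h1 : sigma < 1) {u : ℝ → ℝ} (hu : u ∈ ultraSobolev sigma lam) (q : ℝ[X]) :
    (∫ x, u x * q.eval x ∂(ultraMeasure lam)) ^ 2 ≤ ultraPairing sigma lam u u *
      weightInt (neg_one_lt_sub_half hlam)
        (q * ultraMult hlam (ultraInvMultiplier sigma lam) q) := by
  rw [weightInt_mul_ultraMult_self]
  set b := (ultraPolyBasis hlam).repr q with hb
  have hq : ∀ y, q.eval y = ∑ n ∈ b.support, b n * (ultraPoly lam n).eval y :=
    eval_eq_sum_ultraPoly hlam q
  have hint : ∀ n, Integrable (fun x => u x * (ultraPoly lam n).eval x) (ultraMeasure lam) :=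
    fun n => hu.1.integrable_mul (memLp_ultraMeasure hlam (ultraPoly lam n).continuous)
  have hexp : ∫ x, u x * q.eval x ∂(ultraMeasure lam) =
      ∑ n ∈ b.support, b n * (ultraNorm lam n * ultraCoeff lam u n) := by
    simp only [hq, Finset.mul_sum, mul_left_comm (u _) (b _)]
    rw [integral_finsetSum _ fun n _ => (hint n).const_mul _]
    refine Finset.sum_congr rfl fun n _ => ?_
    rw [integral_const_mul, integral_mul_ultraPoly hlam]
  have hm := ultraMultiplier_pos hlam h0 h1
  have hA : ∀ n ∈ b.support, 0 ≤ ultraMultiplier sigma lam n * (ultraCoeff lam u n) ^ 2 :=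
    fun n _ => mul_nonneg (hm n).le (sq_nonneg _)
  have hB : ∀ n ∈ b.support, 0 ≤ ultraInvMultiplier sigma lam n * b n ^ 2 *
      weightInt (neg_one_lt_sub_half hlam) (ultraPoly lam n * ultraPoly lam n) := fun n _ => by
    rw [← ultraNorm_sq hlam, ultraInvMultiplier_eq_inv]
    have := hm n
    positivity
  rw [hexp]
  refine (Finset.sum_sq_le_sum_mul_sum_of_sq_le_mul _ hA hB fun n _ => Eq.le ?_).trans ?_
  · rw [← ultraNorm_sq hlam, ultraInvMultiplier_eq_inv]
    field_simp [(hm n).ne']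
  · refine mul_le_mul_of_nonneg_right ?_ (Finset.sum_nonneg hB)
    exact sum_le_hasSum _ (fun n _ => mul_nonneg (hm n).le (sq_nonneg _))
      (hasSum_ultraPairing hlam h0 h1 hu)

lemma ultraPairing_nonneg {lam sigma : ℝ} (hlam : 0 < lam) (h0 : 0 < sigma) (h1 : sigma < 1)
    {u : ℝ → ℝ} (hu : u ∈ ultraSobolev sigma lam) : 0 ≤ ultraPairing sigma lam u u :=
  (hasSum_ultraPairing hlam h0 h1 hu).nonneg fun n =>
    mul_nonneg (ultraMultiplier_pos hlam h0 h1 n).le (sq_nonneg _)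

/-- The dual Hardy inequality for `φ g`, with a polynomial minorant `φ` of the extremal function
in place of that function. -/
lemma dual_hardy_polynomial {lam sigma : ℝ} (hlam : 0 < lam) (h0 : 0 < sigma) (h1 : sigma < 1)
    {u : ℝ → ℝ} (hu : u ∈ ultraSobolev sigma lam) {φ : ℝ[X]}
    (hφ : ∀ x ∈ Icc (-1 : ℝ) 1, 0 ≤ φ.eval x)
    (hφ' : ∀ x ∈ Ioo (-1 : ℝ) 1, φ.eval x ≤ (1 - x ^ 2) ^ (-((2 * lam + 1 + sigma) / 4)))
    (g : ℝ[X]) :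
    ultraHardyConst sigma lam * (∫ x, u x * (φ * g).eval x ∂(ultraMeasure lam)) ^ 2 ≤
      ultraPairing sigma lam u u * weightInt (neg_one_lt_exponent_add hlam h0) (φ * g ^ 2) := by
  have hQ := ultraHardyConst_pos hlam h0 h1
  calc _ ≤ ultraHardyConst sigma lam * (ultraPairing sigma lam u u *
        weightInt (neg_one_lt_sub_half hlam)
          (φ * g * ultraMult hlam (ultraInvMultiplier sigma lam) (φ * g))) :=
        mul_le_mul_of_nonneg_left (sq_integral_mul_le_ultraPairing_mul hlam h0 h1 hu _) hQ.le
    _ = ultraPairing sigma lam u u * (ultraHardyConst sigma lam *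
        weightInt (neg_one_lt_sub_half hlam)
          (φ * g * ultraMult hlam (ultraInvMultiplier sigma lam) (φ * g))) := by ring
    _ ≤ _ := mul_le_mul_of_nonneg_left (ultraHardyConst_mul_weightInt_le hlam h0 h1 hφ hφ' g)
        (ultraPairing_nonneg hlam h0 h1 hu)

/-! ### Passage to the limit -/

lemma choose_add_sub_one_nonneg {κ : ℝ} (hκ : 0 < κ) (n : ℕ) :
    0 ≤ Ring.choose (κ + n - 1) n := by
  rw [Ring.choose, show κ + n - 1 - n + 1 = κ by ring]
  have h := Ring.factorial_nsmul_multichoose_eq_ascPochhammer κ n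
  rw [Polynomial.ascPochhammer_smeval_eq_eval, nsmul_eq_mul] at h
  have h2 := ascPochhammer_pos n κ hκ
  rw [← h] at h2
  exact (pos_of_mul_pos_right h2 (by positivity)).le

lemma hasSum_one_sub_sq_rpow_neg (κ : ℝ) {x : ℝ} (hx : x ∈ Ioo (-1 : ℝ) 1) :
    HasSum (fun n : ℕ => Ring.choose (κ + n - 1) n * (x ^ 2) ^ n) ((1 - x ^ 2) ^ (-κ)) := by
  have hx0 := one_sub_sq_pos hx
  have h := (Real.one_div_one_sub_rpow_hasFPowerSeriesOnBall_zero κ).hasSum (y := x ^ 2) (by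
    rw [← ENNReal.ofReal_one, Metric.eball_ofReal, mem_ball_zero_iff, Real.norm_eq_abs,
      abs_of_nonneg (sq_nonneg x)]
    linarith)
  simp only [FormalMultilinearSeries.ofScalars_apply_eq, smul_eq_mul, zero_add] at h
  rwa [one_div, ← Real.rpow_neg hx0.le] at h

/-- The Taylor polynomials of `(1 - x²)^(-κ)` have nonnegative coefficients, hence increase to
this function. -/
lemma exists_polynomial_tendsto_one_sub_sq_rpow_neg {κ : ℝ} (hκ : 0 < κ) :
    ∃ φ : ℕ → ℝ[X], (∀ N x, 1 ≤ (φ N).eval x) ∧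
      (∀ N, ∀ x ∈ Ioo (-1 : ℝ) 1, (φ N).eval x ≤ (1 - x ^ 2) ^ (-κ)) ∧
      ∀ x ∈ Ioo (-1 : ℝ) 1, Tendsto (fun N => (φ N).eval x) atTop (𝓝 ((1 - x ^ 2) ^ (-κ))) := by
  set φ : ℕ → ℝ[X] := fun N =>
    ∑ n ∈ Finset.range (N + 1), C (Ring.choose (κ + n - 1) n) * (X ^ 2) ^ n with hφ
  have heval : ∀ N x, (φ N).eval x =
      ∑ n ∈ Finset.range (N + 1), Ring.choose (κ + n - 1) n * (x ^ 2) ^ n := fun N x => by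
    simp [hφ, eval_finsetSum]
  have hnn : ∀ (x : ℝ) (n : ℕ), 0 ≤ Ring.choose (κ + n - 1) n * (x ^ 2) ^ n := fun x n =>
    mul_nonneg (choose_add_sub_one_nonneg hκ n) (by positivity)
  refine ⟨φ, fun N x => ?_, fun N x hx => ?_, fun x hx => ?_⟩
  · rw [heval, Finset.sum_range_succ']
    have := Finset.sum_nonneg fun (n : ℕ) (_ : n ∈ Finset.range N) => hnn x (n + 1)
    simp only [pow_zero, mul_one, Ring.choose_zero_right]
    linarith
  · rw [heval]
    exact sum_le_hasSum _ (fun n _ => hnn x n) (hasSum_one_sub_sq_rpow_neg κ hx)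
  · simp only [heval]
    exact (tendsto_add_atTop_iff_nat 1).2 (hasSum_one_sub_sq_rpow_neg κ hx).tendsto_sum_nat

lemma tendsto_integral_mul_of_tendsto_eLpNorm {α : Type*} [MeasurableSpace α] {μ : Measure α}
    {F G : ℕ → α → ℝ} {f g : α → ℝ} (hF : ∀ n, MemLp (F n) 2 μ) (hG : ∀ n, MemLp (G n) 2 μ)
    (hf : MemLp f 2 μ) (hg : MemLp g 2 μ)
    (hFf : Tendsto (fun n => eLpNorm (F n - f) 2 μ) atTop (𝓝 0))
    (hGg : Tendsto (fun n => eLpNorm (G n - g) 2 μ) atTop (𝓝 0)) :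
    Tendsto (fun n => ∫ x, F n x * G n x ∂μ) atTop (𝓝 (∫ x, f x * g x ∂μ)) := by
  have hinner : ∀ {a b : α → ℝ} (ha : MemLp a 2 μ) (hb : MemLp b 2 μ),
      inner ℝ (ha.toLp a) (hb.toLp b) = ∫ x, a x * b x ∂μ := by
    intro a b ha hb
    rw [L2.inner_def]
    refine integral_congr_ae ?_
    filter_upwards [ha.coeFn_toLp, hb.coeFn_toLp] with x h1 h2
    rw [h1, h2]
    simp [mul_comm]
  have h1 := (Lp.tendsto_Lp_iff_tendsto_eLpNorm'' F hF f hf).2 hFf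
  have h2 := (Lp.tendsto_Lp_iff_tendsto_eLpNorm'' G hG g hg).2 hGg
  have h := h1.inner (𝕜 := ℝ) h2
  simpa only [hinner] using h

/-- The dual Hardy inequality `Q ⟨u, f⟩² ≤ ⟨u, A u⟩ ∫ f² (1 - x²)^(σ/2) dμ` for continuous `f`. -/
lemma dual_hardy_continuous {lam sigma : ℝ} (hlam : 0 < lam) (h0 : 0 < sigma) (h1 : sigma < 1)
    {u : ℝ → ℝ} (hu : u ∈ ultraSobolev sigma lam) {f : ℝ → ℝ} (hf : Continuous f) :
    ultraHardyConst sigma lam * (∫ x, u x * f x ∂(ultraMeasure lam)) ^ 2 ≤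
      ultraPairing sigma lam u u *
        ∫ x, f x ^ 2 * (1 - x ^ 2) ^ (sigma / 2) ∂(ultraMeasure lam) := by
  obtain ⟨φ, hφ1, hφle, hφlim⟩ := exists_polynomial_tendsto_one_sub_sq_rpow_neg
    (κ := (2 * lam + 1 + sigma) / 4) (by positivity)
  have hφpos : ∀ N x, 0 < (φ N).eval x := fun N x => one_pos.trans_le (hφ1 N x)
  -- Weierstrass approximation of `f / φ N` gives polynomials `g N` with `φ N * g N` uniformly
  -- close to `f`.
  have hex : ∀ N, ∃ g : ℝ[X], ∀ x ∈ Icc (-1 : ℝ) 1,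
      |(φ N).eval x * g.eval x - f x| ≤ 1 / ((N : ℝ) + 1) := by
    intro N
    obtain ⟨B, hB⟩ := isCompact_Icc.exists_bound_of_continuousOn
      ((φ N).continuous.continuousOn (s := Icc (-1 : ℝ) 1))
    have hBpos : 0 < B := by
      have h := hB 0 (by norm_num)
      rw [Real.norm_eq_abs] at h
      exact (hφpos N 0).trans_le ((le_abs_self _).trans h)
    obtain ⟨g, hg⟩ := exists_polynomial_near_of_continuousOn (-1) 1
      (fun x => f x / (φ N).eval x)
      (hf.div (φ N).continuous fun x => (hφpos N x).ne').continuousOn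
      (1 / ((N : ℝ) + 1) / B) (by positivity)
    refine ⟨g, fun x hx => ?_⟩
    have h2 : (φ N).eval x * g.eval x - f x =
        (φ N).eval x * (g.eval x - f x / (φ N).eval x) := by
      have := (hφpos N x).ne'
      field_simp
    rw [h2, abs_mul]
    calc _ ≤ B * (1 / ((N : ℝ) + 1) / B) :=
          mul_le_mul (hB x hx) (hg x hx).le (abs_nonneg _) hBpos.le
      _ = _ := by field_simp
  choose g hg using hex
  have hbound : ∀ N, ∀ x ∈ Icc (-1 : ℝ) 1, |(φ N).eval x * (g N).eval x| ≤ |f x| + 1 := by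
    intro N x hx
    have h2 := hg N x hx
    have h3 : 1 / ((N : ℝ) + 1) ≤ 1 := by
      rw [div_le_one (by positivity)]
      linarith [(N.cast_nonneg : (0 : ℝ) ≤ N)]
    have h4 := abs_sub_abs_le_abs_sub ((φ N).eval x * (g N).eval x) (f x)
    linarith
  have hlim : ∀ x ∈ Icc (-1 : ℝ) 1,
      Tendsto (fun N => (φ N).eval x * (g N).eval x) atTop (𝓝 (f x)) := fun x hx =>
    tendsto_iff_norm_sub_tendsto_zero.2 (squeeze_zero (fun _ => norm_nonneg _)
      (fun N => hg N x hx) tendsto_one_div_add_atTop_nhds_zero_nat)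
  have hleft : Tendsto (fun N => ∫ x, u x * (φ N * g N).eval x ∂(ultraMeasure lam)) atTop
      (𝓝 (∫ x, u x * f x ∂(ultraMeasure lam))) := by
    refine tendsto_integral_of_dominated_convergence (fun x => |u x| * (|f x| + 1)) ?_ ?_ ?_ ?_
    · exact fun N => hu.1.1.mul (φ N * g N).continuous.aestronglyMeasurable
    · exact hu.1.abs.integrable_mul (memLp_ultraMeasure hlam (hf.abs.add continuous_const))
    · refine fun N => ae_ultraMeasure_of_forall_mem fun x hx => ?_
      rw [norm_mul, eval_mul]
      exact mul_le_mul_of_nonneg_left (hbound N x (Ioo_subset_Icc_self hx)) (abs_nonneg _)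
    · refine ae_ultraMeasure_of_forall_mem fun x hx => ?_
      simp only [eval_mul]
      exact (hlim x (Ioo_subset_Icc_self hx)).const_mul _
  have hright : Tendsto (fun N => weightInt (neg_one_lt_exponent_add hlam h0) (φ N * g N ^ 2)) atTop
      (𝓝 (∫ x, f x ^ 2 * (1 - x ^ 2) ^ (sigma / 2) ∂(ultraMeasure lam))) := by
    rw [integral_ultraMeasure]
    simp only [weightInt_apply]
    refine tendsto_integral_of_dominated_convergence
      (fun x => (|f x| + 1) ^ 2 * (1 - x ^ 2) ^ (lam / 2 - 3 / 4 + sigma / 4)) ?_ ?_ ?_ ?_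
    · exact fun N => (integrableOn_mul_weight (neg_one_lt_exponent_add hlam h0)
        (φ N * g N ^ 2).continuous).aestronglyMeasurable
    · exact integrableOn_mul_weight (neg_one_lt_exponent_add hlam h0)
        ((hf.abs.add continuous_const).pow 2)
    · refine fun N => ae_restrict_of_forall_mem measurableSet_Ioo fun x hx => ?_
      have hw := Real.rpow_nonneg (one_sub_sq_pos hx).le (lam / 2 - 3 / 4 + sigma / 4)
      rw [norm_mul, Real.norm_of_nonneg hw]
      refine mul_le_mul_of_nonneg_right ?_ hw
      have h2 := pow_le_pow_left₀ (abs_nonneg _) (hbound N x (Ioo_subset_Icc_self hx)) 2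
      rw [sq_abs] at h2
      refine le_trans ?_ h2
      rw [Real.norm_eq_abs, eval_mul, eval_pow, abs_of_nonneg
        (mul_nonneg (hφpos N x).le (sq_nonneg _)), mul_pow]
      exact mul_le_mul_of_nonneg_right (le_self_pow₀ (hφ1 N x) two_ne_zero) (sq_nonneg _)
    · refine ae_restrict_of_forall_mem measurableSet_Ioo fun x hx => ?_
      have hx0 := one_sub_sq_pos hx
      have h2 := (((hlim x (Ioo_subset_Icc_self hx)).pow 2).div (hφlim x hx)
        (Real.rpow_pos_of_pos hx0 _).ne').mul_const
          ((1 - x ^ 2) ^ (lam / 2 - 3 / 4 + sigma / 4))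
      have h3 : f x ^ 2 / (1 - x ^ 2) ^ (-((2 * lam + 1 + sigma) / 4)) *
          (1 - x ^ 2) ^ (lam / 2 - 3 / 4 + sigma / 4) =
          f x ^ 2 * (1 - x ^ 2) ^ (sigma / 2) * (1 - x ^ 2) ^ (lam - 1 / 2) := by
        rw [Real.rpow_neg hx0.le, div_inv_eq_mul, mul_assoc, mul_assoc, ← Real.rpow_add hx0,
          ← Real.rpow_add hx0]
        congr 2
        ring
      rw [h3] at h2
      refine h2.congr fun N => ?_
      have := (hφpos N x).ne'
      simp only [Pi.div_apply, eval_mul, eval_pow]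
      field_simp
  exact le_of_tendsto_of_tendsto' ((hleft.pow 2).const_mul _) (hright.const_mul _) fun N =>
    dual_hardy_polynomial hlam h0 h1 hu (fun x _ => (hφpos N x).le) (hφle N) (g N)

lemma norm_one_sub_sq_rpow_le_one {s x : ℝ} (hs : 0 ≤ s) (hx : x ∈ Ioo (-1 : ℝ) 1) :
    ‖(1 - x ^ 2) ^ s‖ ≤ 1 := by
  have hx0 := one_sub_sq_pos hx
  rw [Real.norm_of_nonneg (Real.rpow_nonneg hx0.le _)]
  exact Real.rpow_le_one hx0.le (by linarith [sq_nonneg x]) hs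

lemma MeasureTheory.MemLp.mul_one_sub_sq_rpow {lam s : ℝ} (hs : 0 ≤ s) {f : ℝ → ℝ}
    (hf : MemLp f 2 (ultraMeasure lam)) :
    MemLp (fun x => f x * (1 - x ^ 2) ^ s) 2 (ultraMeasure lam) := by
  refine hf.of_le (hf.1.mul (Measurable.aestronglyMeasurable (by fun_prop))) ?_
  refine ae_ultraMeasure_of_forall_mem fun x hx => ?_
  rw [norm_mul]
  exact mul_le_of_le_one_right (norm_nonneg _) (norm_one_sub_sq_rpow_le_one hs hx)

lemma integral_sq_mul_one_sub_sq_rpow (lam sigma : ℝ) (f : ℝ → ℝ) :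
    ∫ x, f x ^ 2 * (1 - x ^ 2) ^ (sigma / 2) ∂(ultraMeasure lam) =
      ∫ x, (f x * (1 - x ^ 2) ^ (sigma / 4)) * (f x * (1 - x ^ 2) ^ (sigma / 4))
        ∂(ultraMeasure lam) := by
  refine integral_congr_ae (ae_ultraMeasure_of_forall_mem fun x hx => ?_)
  simp only
  rw [show sigma / 2 = sigma / 4 + sigma / 4 by ring, Real.rpow_add (one_sub_sq_pos hx)]
  ring

/-- The dual Hardy inequality extends from continuous functions to `L²(μ_λ)`, since the weight
`(1 - x²)^(σ/2)` is bounded; at `f = u` it is the uncertainty principle. -/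
lemma heisenberg_ultraPairing {lam sigma : ℝ} (hlam : 0 < lam) (h0 : 0 < sigma) (h1 : sigma < 1)
    {u : ℝ → ℝ} (hu : u ∈ ultraSobolev sigma lam) :
    ultraHardyConst sigma lam * (∫ x, u x ^ 2 ∂(ultraMeasure lam)) ^ 2 ≤
      ultraPairing sigma lam u u *
        ∫ x, u x ^ 2 * (1 - x ^ 2) ^ (sigma / 2) ∂(ultraMeasure lam) := by
  have := isFiniteMeasure_ultraMeasure hlam
  have hex : ∀ n : ℕ, ∃ f : ℝ → ℝ, Continuous f ∧ MemLp f 2 (ultraMeasure lam) ∧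
      eLpNorm (f - u) 2 (ultraMeasure lam) ≤ ((n : ENNReal) + 1)⁻¹ := by
    intro n
    obtain ⟨f, -, hfu, hf, hfL⟩ := hu.1.exists_hasCompactSupport_eLpNorm_sub_le
      ENNReal.ofNat_ne_top (ε := ((n : ENNReal) + 1)⁻¹) (by simp)
    exact ⟨f, hf, hfL, by rwa [eLpNorm_sub_comm]⟩
  choose f hf hfL hfu using hex
  have hlim : Tendsto (fun n => eLpNorm (f n - u) 2 (ultraMeasure lam)) atTop (𝓝 0) := by
    refine tendsto_of_tendsto_of_tendsto_of_le_of_le tendsto_const_nhds ?_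
      (fun _ => zero_le) hfu
    have h := (tendsto_add_atTop_iff_nat 1).2 ENNReal.tendsto_inv_nat_nhds_zero
    simpa using h
  have hs : 0 ≤ sigma / 4 := by positivity
  have hlim' : Tendsto (fun n => eLpNorm ((fun x => f n x * (1 - x ^ 2) ^ (sigma / 4)) -
      fun x => u x * (1 - x ^ 2) ^ (sigma / 4)) 2 (ultraMeasure lam)) atTop (𝓝 0) := by
    refine tendsto_of_tendsto_of_tendsto_of_le_of_le tendsto_const_nhds hlim
      (fun _ => zero_le) fun n => ?_
    refine eLpNorm_mono_ae (ae_ultraMeasure_of_forall_mem fun x hx => ?_)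
    simp only [Pi.sub_apply]
    rw [← sub_mul, norm_mul]
    exact mul_le_of_le_one_right (norm_nonneg _) (norm_one_sub_sq_rpow_le_one hs hx)
  have hleft := tendsto_integral_mul_of_tendsto_eLpNorm (fun _ => hu.1) hfL hu.1 hu.1
    (by simp) hlim
  have hright := tendsto_integral_mul_of_tendsto_eLpNorm
    (fun n => (hfL n).mul_one_sub_sq_rpow hs) (fun n => (hfL n).mul_one_sub_sq_rpow hs)
    (hu.1.mul_one_sub_sq_rpow hs) (hu.1.mul_one_sub_sq_rpow hs) hlim' hlim'
  simp only [← integral_sq_mul_one_sub_sq_rpow] at hright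
  simp only [sq (u _)] at hright ⊢
  exact le_of_tendsto_of_tendsto' ((hleft.pow 2).const_mul _) (hright.const_mul _) fun n =>
    dual_hardy_continuous hlam h0 h1 hu (hf n)

lemma ultraPairing_eq_integral {lam sigma : ℝ} (hlam : 0 < lam) (h0 : 0 < sigma) (h1 : sigma < 1)
    {u g : ℝ → ℝ} (hu : u ∈ ultraSobolev sigma lam) (hg : IsUltraOp sigma lam u g) :
    ultraPairing sigma lam u u = ∫ x, u x * g x ∂(ultraMeasure lam) := by
  have hterm : ∀ n, MemLp (ultraOpTerm sigma lam u n) 2 (ultraMeasure lam) := fun n =>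
    memLp_ultraMeasure hlam (((ultraPoly lam n).continuous.const_mul _).const_mul _)
  have hsum : ∀ N, MemLp (fun x => ∑ n ∈ Finset.range N, ultraOpTerm sigma lam u n x) 2
      (ultraMeasure lam) := fun N => memLp_finsetSum _ fun n _ => hterm n
  have hlim := tendsto_integral_mul_of_tendsto_eLpNorm (fun _ => hu.1) hsum hu.1 hg.1
    (by simp) hg.2
  refine tendsto_nhds_unique (hasSum_ultraPairing hlam h0 h1 hu).tendsto_sum_nat
    (hlim.congr fun N => ?_)
  have hint : ∀ n, Integrable (fun x => u x * ultraOpTerm sigma lam u n x) (ultraMeasure lam) :=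
    fun n => hu.1.integrable_mul (hterm n)
  simp only [Finset.mul_sum]
  rw [integral_finsetSum _ fun n _ => hint n]
  refine Finset.sum_congr rfl fun n _ => ?_
  rw [integral_mul_ultraOpTerm]
  ring

theorem mainTheorem3 (lam sigma : ℝ) (hlam : 0 < lam) (hsigma0 : 0 < sigma) (hsigma1 : sigma < 1)
    (u : ℝ → ℝ) (hu : u ∈ ultraSobolev sigma lam) :
    -- the pairing `⟨u, A u⟩` is finite, with the expected value in Fourier coefficients
    HasSum (fun n : ℕ => ultraMultiplier sigma lam n * (ultraCoeff lam u n) ^ 2)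
      (ultraPairing sigma lam u u) ∧
    -- it is the integral of `u` times `A u` whenever `A u` is a function in `L²`
    (∀ g : ℝ → ℝ, IsUltraOp sigma lam u g →
      ultraPairing sigma lam u u = ∫ x, u x * g x ∂(ultraMeasure lam)) ∧
    Integrable (fun x => u x ^ 2) (ultraMeasure lam) ∧
    Integrable (fun x => u x ^ 2 * (1 - x ^ 2) ^ (sigma / 2)) (ultraMeasure lam) ∧
    ultraHardyConst sigma lam * (∫ x, u x ^ 2 ∂(ultraMeasure lam)) ^ 2 ≤
      (∫ x, u x ^ 2 * (1 - x ^ 2) ^ (sigma / 2) ∂(ultraMeasure lam)) *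
        ultraPairing sigma lam u u := by
  refine ⟨hasSum_ultraPairing hlam hsigma0 hsigma1 hu,
    fun g hg => ultraPairing_eq_integral hlam hsigma0 hsigma1 hu hg, hu.1.integrable_sq, ?_, ?_⟩
  · have hu2 := hu.1.integrable_sq
    refine hu2.mono' (hu2.1.mul (Measurable.aestronglyMeasurable (by fun_prop))) ?_
    refine ae_ultraMeasure_of_forall_mem fun x hx => ?_
    rw [norm_mul, Real.norm_of_nonneg (sq_nonneg _)]
    exact mul_le_of_le_one_right (sq_nonneg _)
      (norm_one_sub_sq_rpow_le_one (by positivity) hx)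
  · rw [mul_comm (∫ x, _ ∂_)]
    exact heisenberg_ultraPairing hlam hsigma0 hsigma1 hu
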